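/- **Aligned cubic trees.** An *aligned cubic tree* is a plane drawing of a finite tree all of whose vertices have degree $3$ (*nodes*) or $1$ (*leaves*), in which every edge is a segment whose direction is a multiple of $60^\circ$ from the vertical, and the three edges at each node make angles of $120^\circ$; drawings that differ only by translation and by the lengths of edges are identified. Equivalently, one takes planted full binary trees, drawn with all angles at the nodes equal to $120^\circ$ and with any of the six directions (multiples of $60^\circ$ from South) for the root edge, and forgets the root. An *$n$-ctree* is an aligned cubic tree with $n$ nodes. No edge is horizontal, so each edge has a top and a bottom vertex. A node is *hidden*, *exposed*, *naked* if exactly $0$, $1$, $2$ of its three neighbours are leaves. The *center* of a ctree is its unique edge if $n=0$ and its unique node if $n=1$; if $n\ge 2$, delete the leaves (with their edges) adjacent to each naked node, and repeat until $0$ nodes or $1$ node remain. So the center is either an edge or a node. **Configurations.** An *$(n,k)$-configuration* is a $k$-ctree together with, on each of its $2k+1$ edges, a (possibly empty) strip of squares, with $n-2-2k$ squares in all; each square is labelled $L$ or $R$, except that if there is a center edge and it carries an odd number of squares, then the first square of its strip is labelled $T$ or $B$ instead. **Construction.** Left and right are always relative to the stated direction of travel. Given an $(n,k)$-configuration: *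 Each non-center edge with $i$ squares receives $i$ exposed nodes. The labels, in order, belong to these nodes from the one farthest from the center to the one nearest to it, and tell whether the leaf at that node is on the left or on the right when travelling from the center; the part of the tree beyond continues on the other side. The left and right branches at every node of the $k$-ctree, travelling from the center, are kept. * Each leaf of the $k$-ctree is turned into a naked node by adding two edges. * If the center is a node, it remains, with its three edges in the same directions. * If the center is an edge with $2m$ squares, it remains an edge with the same direction, and $m$ exposed nodes are inserted on each side of it. The labels, in order, are applied along the way from the part at the bottom vertex to the part at the top vertex, and tell the side of each leaf when travelling from the center edge. * If the center is an edge with $2m+1$ squares, it becomes a leaf edge with the same direction: its bottom vertex becomes a leaf if the first label is $B$, its top vertex if the first label is $T$. Travelling from this leaf, the part of the tree that was at the vertex which is now the leaf is placed at the end of the left branch at the other vertex, the other part is placed at the end of the right branch, and $m$ exposed nodes are inserted on each of the two branches. The remaining $2m$ labels, in order, are applied along the way from the end of the left branch to the end of the right branch, and tell the side of each leaf when travelling from the leaf. **Theorem.** Let $u_n=\dfrac{\binom{4}{2}\binom{2n}{n}}{2\binom{n+2}{2}}$ be the super-Catalan numbers of order $2$. For every $n\ge 0$ there are exactly $u_n$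 $n$-ctrees. Let $n\ge2$. For every $k\ge 0$ the construction is well defined and is a bijection from the set of $(n,k)$-configurations to the set of $n$-ctrees with exactly $k$ hidden nodes; the numbers of naked, hidden and exposed nodes of the image are the numbers of leaves, nodes and squares of the configuration, respectively. Each of the two sets has $$\binom{n-2}{2k}\,2^{\,n-2-2k}\,u_k$$ elements (to be read as $0$ if $2k>n-2$). Hence $$u_n=\sum_{k=0}^{\lfloor n/2\rfloor-1}\binom{n-2}{2k}\,2^{\,n-2-2k}\,u_k ,$$ and this sum counts the $n$-ctrees by their number $k$ of hidden nodes. -/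

import Mathlib

namespace AlignedCubic

/-- What a traveller sees beyond an edge: either the far end of the edge is a leaf, or it is a node,
with a left edge (marked `a`, subtree `l` beyond it) and a right edge (marked `b`, subtree `r`).
Every edge carries a mark in `α`. -/
inductive Sub (α : Type) : Type
  | leaf : Sub α
  | node (a : α) (l : Sub α) (b : α) (r : Sub α) : Sub α

/-- An aligned cubic tree with marked edges, seen by a traveller on one of its edges. The traveller
moves in direction `dir`, measured counterclockwise from South in multiples of 60 degrees; the edge
carries `mark`; `front` is the part ahead, and `back` is the part seen after turning round.
A tree rooted at a leaf, coded by the direction of the root edge and a planted full binary tree,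
is a drawing with `back = leaf`. -/
structure Drawing (α : Type) : Type where
  dir : ZMod 6
  mark : α
  front : Sub α
  back : Sub α

/-- The moves of the traveller: turning round on an edge, and passing a node to its left or right
branch. All angles at a node are 120 degrees, so a left (right) turn changes the direction
by +60 (-60) degrees. -/
inductive Step {α : Type} : Drawing α → Drawing α → Prop
  | turn (d : ZMod 6) (a : α) (X Y : Sub α) :
      Step ⟨d, a, X, Y⟩ ⟨d + 3, a, Y, X⟩
  | left (d : ZMod 6) (a b c : α) (X Y Z : Sub α) :
      Step ⟨d, a, .node b X c Y, Z⟩ ⟨d + 1, b, X, .node c Y a Z⟩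
  | right (d : ZMod 6) (a b c : α) (X Y Z : Sub α) :
      Step ⟨d, a, .node b X c Y, Z⟩ ⟨d - 1, c, Y, .node a Z b X⟩

/-- Aligned cubic trees with edges marked in `α`: drawings, with the traveller forgotten
(the equivalence relation is the one generated by `Step`). -/
def MarkedTree (α : Type) : Type := Quot (Step (α := α))

namespace Sub

variable {α : Type}

def isLeaf : Sub α → Bool
  | leaf => true
  | node _ _ _ _ => false

/-- Number of nodes (vertices of degree 3). -/
def numNodes : Sub α → ℕ
  | leaf => 0
  | node _ l _ r => 1 + l.numNodes + r.numNodes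

/-- Number of leaves (vertices of degree 1). -/
def numLeaves : Sub α → ℕ
  | leaf => 1
  | node _ l _ r => l.numLeaves + r.numLeaves

/-- Sum of `w` over the marks of the edges. -/
def weight (w : α → ℕ) : Sub α → ℕ
  | leaf => 0
  | node a l b r => w a + l.weight w + (w b + r.weight w)

/-- The number of leaves among the three neighbours of the first node, where `p` tells whether
the neighbour from which the traveller comes is a leaf. -/
def leafNeighbors (p : Bool) : Sub α → ℕ
  | leaf => 0
  | node _ l _ r => p.toNat + l.isLeaf.toNat + r.isLeaf.toNat

/-- The number of nodes with exactly `j` leaves among their neighbours, where `p` tells whether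
the vertex from which the traveller comes is a leaf. -/
def nodesWith (j : ℕ) : Bool → Sub α → ℕ
  | _, leaf => 0
  | p, node a l b r =>
      (if (node a l b r).leafNeighbors p = j then 1 else 0)
        + nodesWith j false l + nodesWith j false r

/-- Delete the two leaves at each node both of whose branches are leaves. -/
def prune : Sub α → Sub α
  | leaf => leaf
  | node a l b r => if l.isLeaf && r.isLeaf then leaf else node a l.prune b r.prune

end Sub

namespace Drawing

variable {α : Type}

def numNodes (D : Drawing α) : ℕ := D.front.numNodes + D.back.numNodes

def numLeaves (D : Drawing α) : ℕ := D.front.numLeaves + D.back.numLeaves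

def weight (w : α → ℕ) (D : Drawing α) : ℕ := w D.mark + D.front.weight w + D.back.weight w

def nodesWith (j : ℕ) (D : Drawing α) : ℕ :=
  D.front.nodesWith j D.back.isLeaf + D.back.nodesWith j D.front.isLeaf

/-- The traveller's edge joins a leaf to a naked node (one with exactly two leaf neighbours). -/
def OnNakedLeafEdge (D : Drawing α) : Prop :=
  (D.back.isLeaf = true ∧ D.front.leafNeighbors D.back.isLeaf = 2) ∨
  (D.front.isLeaf = true ∧ D.back.leafNeighbors D.front.isLeaf = 2)

/-- For a tree with at least two nodes: delete the leaves, with their edges, adjacent to each naked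
node. This is only used when the traveller's edge is not deleted. -/
def prune (D : Drawing α) : Drawing α := ⟨D.dir, D.mark, D.front.prune, D.back.prune⟩

/-- The traveller's edge is the center: repeated pruning, as long as there are at least two nodes,
ends with this edge alone. -/
inductive IsCenterEdge : Drawing α → Prop
  | base (d : ZMod 6) (a : α) : IsCenterEdge ⟨d, a, .leaf, .leaf⟩
  | prune (D : Drawing α) : 2 ≤ D.numNodes → ¬ D.OnNakedLeafEdge →
      IsCenterEdge D.prune → IsCenterEdge D

/-- The vertex just ahead of the traveller is a node and is the center: repeated pruning, as long
as there are at least two nodes, ends with this vertex as the only node. -/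
inductive IsCenterNode : Drawing α → Prop
  | base (D : Drawing α) : D.numNodes = 1 → D.front.isLeaf = false → IsCenterNode D
  | prune (D : Drawing α) : 2 ≤ D.numNodes → D.front.isLeaf = false →
      D.front.leafNeighbors D.back.isLeaf ≠ 2 → IsCenterNode D.prune → IsCenterNode D

end Drawing

theorem Step.numNodes_eq {α : Type} {D E : Drawing α} (h : Step D E) :
    D.numNodes = E.numNodes := by
  cases h <;> simp only [Drawing.numNodes, Sub.numNodes] <;> omega

theorem Step.numLeaves_eq {α : Type} {D E : Drawing α} (h : Step D E) :
    D.numLeaves = E.numLeaves := by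
  cases h <;> simp only [Drawing.numLeaves, Sub.numLeaves] <;> omega

theorem Step.weight_eq {α : Type} (w : α → ℕ) {D E : Drawing α} (h : Step D E) :
    D.weight w = E.weight w := by
  cases h <;> simp only [Drawing.weight, Sub.weight] <;> omega

theorem Step.nodesWith_eq {α : Type} (j : ℕ) {D E : Drawing α} (h : Step D E) :
    D.nodesWith j = E.nodesWith j := by
  cases h with
  | turn d a X Y => simp only [Drawing.nodesWith]; omega
  | left d a b c X Y Z =>
    have h : (Sub.node b X c Y).leafNeighbors Z.isLeaf
        = (Sub.node c Y a Z).leafNeighbors X.isLeaf := by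
      simp only [Sub.leafNeighbors]; omega
    simp only [Drawing.nodesWith, Sub.nodesWith, h]
    simp only [Sub.isLeaf]
    omega
  | right d a b c X Y Z =>
    have h : (Sub.node b X c Y).leafNeighbors Z.isLeaf
        = (Sub.node a Z b X).leafNeighbors Y.isLeaf := by
      simp only [Sub.leafNeighbors]; omega
    simp only [Drawing.nodesWith, Sub.nodesWith, h]
    simp only [Sub.isLeaf]
    omega

namespace MarkedTree

variable {α : Type}

/-- The tree that the traveller is in. -/
def mk (D : Drawing α) : MarkedTree α := Quot.mk _ D

def numNodes (t : MarkedTree α) : ℕ := Quot.lift Drawing.numNodes (fun _ _ h => h.numNodes_eq) t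

def numLeaves (t : MarkedTree α) : ℕ := Quot.lift Drawing.numLeaves (fun _ _ h => h.numLeaves_eq) t

/-- Sum of `w` over the marks of all edges. -/
def weight (w : α → ℕ) (t : MarkedTree α) : ℕ :=
  Quot.lift (Drawing.weight w) (fun _ _ h => h.weight_eq w) t

/-- The number of nodes with exactly `j` leaves among their three neighbours. -/
def nodesWith (j : ℕ) (t : MarkedTree α) : ℕ :=
  Quot.lift (Drawing.nodesWith j) (fun _ _ h => h.nodesWith_eq j) t

/-- Hidden nodes: no neighbour is a leaf. -/
def hidden (t : MarkedTree α) : ℕ := t.nodesWith 0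

/-- Exposed nodes: exactly one neighbour is a leaf. -/
def exposed (t : MarkedTree α) : ℕ := t.nodesWith 1

/-- Naked nodes: exactly two neighbours are leaves. -/
def naked (t : MarkedTree α) : ℕ := t.nodesWith 2

end MarkedTree

/-- An `n`-ctree: an aligned cubic tree (without marks) on `n` nodes. -/
def CTree (n : ℕ) : Type := {t : MarkedTree Unit // t.numNodes = n}

/-- `n`-ctrees with exactly `k` hidden nodes. -/
def CTreeHidden (n k : ℕ) : Type := {t : CTree n // t.1.hidden = k}

/-- Left / right labels of squares. -/
inductive Side : Type
  | L
  | R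

/-- Top / bottom labels of squares. -/
inductive Tip : Type
  | T
  | B

/-- A strip of labelled squares: all squares labelled `L`/`R`, or the first one labelled `T`/`B`
and the others `L`/`R`. -/
inductive Strip : Type
  | plain (s : List Side) : Strip
  | tweaked (v : Tip) (s : List Side) : Strip

namespace Strip

/-- The number of squares. -/
def length : Strip → ℕ
  | plain s => s.length
  | tweaked _ s => s.length + 1

/-- The `L`/`R` labels in order. -/
def sides : Strip → List Side
  | plain s => s
  | tweaked _ s => s

def IsTweaked : Strip → Prop
  | plain _ => False
  | tweaked _ _ => True

end Strip

/-- The first square of a strip is labelled `T`/`B` exactly when the strip has odd length and lies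
on the center edge. The drawings `D` of `c` run over all edges of `c`. -/
def WellLabelled (c : MarkedTree Strip) : Prop :=
  ∀ D : Drawing Strip, MarkedTree.mk D = c →
    (D.mark.IsTweaked ↔ D.IsCenterEdge ∧ Odd D.mark.length)

/-- An `(n,k)`-configuration: a `k`-ctree with a labelled strip on each edge, having
`n - 2 - 2 * k` squares altogether. -/
def Config (n k : ℕ) : Type :=
  {c : MarkedTree Strip // c.numNodes = k ∧ c.weight Strip.length + (2 + 2 * k) = n ∧
    WellLabelled c}

/-- Insert an exposed node whose leaf is on the given side when travelling from the center. -/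
def insertNode (Y : Sub Unit) : Side → Sub Unit
  | .L => .node () .leaf () Y
  | .R => .node () Y () .leaf

/-- Turn a strip of `L`/`R` squares on the edge leading from the center to `X` into exposed nodes;
the first label belongs to the exposed node farthest from the center. -/
def hang (s : List Side) (X : Sub Unit) : Sub Unit := s.foldl insertNode X

/-- Treatment of a part of a configuration beyond an edge, travelling away from the center: strips
on its edges become exposed nodes, and leaves become naked nodes. -/
def expand : Sub Strip → Sub Unit
  | .leaf => .node () .leaf () .leaf
  | .node a l b r => .node () (hang a.sides (expand l)) () (hang b.sides (expand r))

/-- Directions leading from the bottom vertex of an edge to its top vertex. -/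
def IsUp (d : ZMod 6) : Prop := d = 2 ∨ d = 3 ∨ d = 4

/-- `Produces c t`: the construction, started from the center of the configuration `c`,
gives the tree `t`. For a center edge, `X` is the part at its top vertex and `Y` the part at its
bottom vertex. -/
inductive Produces : MarkedTree Strip → MarkedTree Unit → Prop
  /-- The center is a node. -/
  | node (d : ZMod 6) (a b c : Strip) (X Y Z : Sub Strip) :
      Drawing.IsCenterNode (⟨d, a, .node b X c Y, Z⟩ : Drawing Strip) →
      Produces (.mk ⟨d, a, .node b X c Y, Z⟩)
        (.mk ⟨d, (), .node () (hang b.sides (expand X)) () (hang c.sides (expand Y)),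
          hang a.sides (expand Z)⟩)
  /-- Center edge with an even number `2 * m` of squares: `m` exposed nodes on either side of the
  edge, the labels being applied from the bottom part to the top part. -/
  | even (d : ZMod 6) (s : List Side) (m : ℕ) (X Y : Sub Strip) :
      IsUp d → Drawing.IsCenterEdge (⟨d, .plain s, X, Y⟩ : Drawing Strip) → s.length = 2 * m →
      Produces (.mk ⟨d, .plain s, X, Y⟩)
        (.mk ⟨d, (), hang (s.drop m).reverse (expand X), hang (s.take m) (expand Y)⟩)
  /-- Center edge with `2 * m + 1` squares, the first labelled `B`: the bottom vertex becomes a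
  leaf; seen from it, the left branch at the top vertex ends in the bottom part, the right branch
  in the top part, with `m` exposed nodes on each; the labels run from left to right. -/
  | bottom (d : ZMod 6) (s : List Side) (m : ℕ) (X Y : Sub Strip) :
      IsUp d → Drawing.IsCenterEdge (⟨d, .tweaked .B s, X, Y⟩ : Drawing Strip) →
      s.length = 2 * m →
      Produces (.mk ⟨d, .tweaked .B s, X, Y⟩)
        (.mk ⟨d, (), .node () (hang (s.take m) (expand Y)) ()
          (hang (s.drop m).reverse (expand X)), .leaf⟩)
  /-- The same with the label `T`: the top vertex becomes a leaf. -/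
  | top (d : ZMod 6) (s : List Side) (m : ℕ) (X Y : Sub Strip) :
      IsUp d → Drawing.IsCenterEdge (⟨d, .tweaked .T s, X, Y⟩ : Drawing Strip) →
      s.length = 2 * m →
      Produces (.mk ⟨d, .tweaked .T s, X, Y⟩)
        (.mk ⟨d + 3, (), .node () (hang (s.take m) (expand X)) ()
          (hang (s.drop m).reverse (expand Y)), .leaf⟩)

/-- The super-Catalan number of order `m` and index `n`. -/
def superCatalan (m n : ℕ) : ℚ :=
  (((2 * m).choose m : ℚ) * ((2 * n).choose n : ℚ)) / (2 * ((m + n).choose m : ℚ))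

end AlignedCubic

namespace AlignedCubic

/-! A tree is a class of drawings under the moves of a traveller, so everything rests on canonical
representatives. Suppose each drawing tells whether some distinguished edge or node lies strictly
ahead (`Compass`). Walking towards that place ends on the edge or at the node. Directions then
single out one traveller: the one going up among the two on the edge, or the one with direction `0`
or `1` among the three entering the node. Hence `rep` is constant on classes (`rep_eq`), and classes
correspond to `Normal` drawings; there are no symmetries to divide by.

Three compasses are used. `CenterAhead` compares heights, and its place is the center defined by
pruning (`isCenterEdge_iff_flat`, `isCenterNode_iff_sink`). `SkelAhead` compares, in the constructed
tree, the heights of the skeleton and then the numbers of exposed nodes passed; its place is where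
the construction leaves the center: a hidden node, the middle edge of an even center strip, or the
middle exposed node of an odd one. `MarkAhead` points to a single marked edge.

For the bijection, `hang` and `expand` on the branches away from the center are undone by
`contract`. The construction is a function of the `CenterAhead` normal form (`Produces.eq_build`),
and the configuration is a function of the `SkelAhead` normal form of the image
(`Produces.eq_unbuild`); `Produces.surjective` gives the rest.

For the counts, normality for `CenterAhead` depends on the shape alone, so marking the edges of the
`k`-ctrees multiplies their number by that of lists of `2 * k + 1` marks (`card_marked`). Trees with
one marked edge, counted also by the normal traveller on that edge, give `card_cTree_mul` and hence
the super-Catalan numbers. Configurations are trees marked by `L`/`R` lists, up to renaming one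
label, which gives `card_config`; summing over the number of hidden nodes gives the identity. -/

instance (d : ZMod 6) : Decidable (IsUp d) := inferInstanceAs (Decidable (_ ∨ _ ∨ _))

theorem isUp_add_three (d : ZMod 6) : IsUp (d + 3) ↔ ¬ IsUp d := by
  revert d; decide

theorem add_three_add_three (d : ZMod 6) : d + 3 + 3 = d := by
  revert d; decide

/-! ### Normal forms of drawings relative to a distinguished place -/

namespace Drawing

variable {α : Type}

/-- Turning round. -/
def turn (D : Drawing α) : Drawing α := ⟨D.dir + 3, D.mark, D.back, D.front⟩

/-- Arriving at the node ahead from its left branch instead. -/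
def rot : Drawing α → Drawing α
  | ⟨d, a, .leaf, Z⟩ => ⟨d, a, .leaf, Z⟩
  | ⟨d, a, .node b X c Y, Z⟩ => ⟨d + 4, b, .node c Y a Z, X⟩

@[simp] theorem turn_turn (D : Drawing α) : D.turn.turn = D := by
  simp [turn, add_three_add_three]

@[simp] theorem rot_rot_rot (D : Drawing α) : D.rot.rot.rot = D := by
  obtain ⟨d, a, _ | ⟨b, X, c, Y⟩, Z⟩ := D
  · rfl
  · simp only [rot, mk.injEq, and_true]
    revert d; decide

@[simp] theorem isLeaf_front_rot (D : Drawing α) : D.rot.front.isLeaf = D.front.isLeaf := by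
  obtain ⟨d, a, _ | ⟨b, X, c, Y⟩, Z⟩ := D <;> rfl

theorem mk_turn (D : Drawing α) : MarkedTree.mk D.turn = MarkedTree.mk D :=
  (Quot.sound (Step.turn D.dir D.mark D.front D.back)).symm

theorem mk_rot (D : Drawing α) : MarkedTree.mk D.rot = MarkedTree.mk D := by
  obtain ⟨d, a, _ | ⟨b, X, c, Y⟩, Z⟩ := D
  · rfl
  · have h : d + 4 = d + 1 + 3 := by ring
    simp only [rot, h]
    exact ((Quot.sound (Step.left d a b c X Y Z)).trans (Quot.sound (Step.turn _ _ _ _))).symm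

theorem step_iff {D E : Drawing α} (h : Step D E) :
    E = D.turn ∨ E = D.rot.turn ∨ E = D.rot.rot.turn := by
  cases h with
  | turn => exact Or.inl rfl
  | left d =>
    refine Or.inr (Or.inl ?_)
    simp only [turn, rot, mk.injEq, and_true]
    revert d; decide
  | right d =>
    refine Or.inr (Or.inr ?_)
    simp only [turn, rot, mk.injEq, and_true]
    revert d; decide

/-- `F D` says that the distinguished edge or node is strictly ahead of the traveller; at every
node at most one of the three edges does not lead to it from outside. -/
structure Compass (P F : Drawing α → Prop) : Prop where
  turn : ∀ D, P D → P D.turn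
  rot : ∀ D, P D → P D.rot
  asymm : ∀ D, P D → F D → ¬ F D.turn
  leaf : ∀ D, P D → D.front.isLeaf = true → ¬ F D
  node : ∀ D, P D → D.front.isLeaf = false → ¬ F D → F D.rot ∧ F D.rot.rot

/-- The distinguished place is the traveller's edge. -/
def Flat (F : Drawing α → Prop) (D : Drawing α) : Prop := ¬ F D ∧ ¬ F D.turn

/-- The distinguished place is the node ahead of the traveller. -/
def Sink (F : Drawing α → Prop) (D : Drawing α) : Prop :=
  D.front.isLeaf = false ∧ F D ∧ F D.rot ∧ F D.rot.rot

def Normal (F : Drawing α → Prop) (D : Drawing α) : Prop :=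
  (D.Flat F ∧ IsUp D.dir) ∨ (D.Sink F ∧ (D.dir = 0 ∨ D.dir = 1))

def edgeRep (D : Drawing α) : Drawing α := if IsUp D.dir then D else D.turn

/-- The travellers entering a node have directions `d`, `d + 4`, `d + 2`, which have equal parity,
so exactly one of them is `0` or `1`. -/
def nodeRep (D : Drawing α) : Drawing α :=
  if D.dir = 0 ∨ D.dir = 1 then D else if D.dir = 2 ∨ D.dir = 3 then D.rot else D.rot.rot

theorem edgeRep_turn (D : Drawing α) : D.turn.edgeRep = D.edgeRep := by
  by_cases h : IsUp D.dir <;> simp [edgeRep, h, turn, isUp_add_three, add_three_add_three]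

theorem dir_rot {D : Drawing α} (h : D.front.isLeaf = false) : D.rot.dir = D.dir + 4 := by
  obtain ⟨d, a, _ | ⟨b, X, c, Y⟩, Z⟩ := D
  · simp [Sub.isLeaf] at h
  · rfl

theorem nodeRep_rot {D : Drawing α} (h : D.front.isLeaf = false) : D.rot.nodeRep = D.nodeRep := by
  have h1 := dir_rot h
  simp only [nodeRep, h1, rot_rot_rot]
  generalize D.dir = d
  generalize D.rot.rot = R
  generalize D.rot = Q
  have : ∀ x : ZMod 6, x = 0 ∨ x = 1 ∨ x = 2 ∨ x = 3 ∨ x = 4 ∨ x = 5 := by decide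
  obtain rfl | rfl | rfl | rfl | rfl | rfl := this d <;> rfl

theorem nodeRep_normal {D : Drawing α} (h : D.front.isLeaf = false) :
    D.nodeRep.dir = 0 ∨ D.nodeRep.dir = 1 := by
  have h1 := dir_rot h
  have h2 := dir_rot ((isLeaf_front_rot D).trans h)
  rw [h1] at h2
  simp only [nodeRep]
  split_ifs with h3 h4
  · exact h3
  · rw [h1]; revert h4; generalize D.dir = d; revert d; decide
  · rw [h2]; revert h3 h4; generalize D.dir = d; revert d; decide

theorem mk_edgeRep (D : Drawing α) : MarkedTree.mk D.edgeRep = MarkedTree.mk D := by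
  unfold edgeRep; split_ifs
  · rfl
  · exact mk_turn D

theorem mk_nodeRep (D : Drawing α) : MarkedTree.mk D.nodeRep = MarkedTree.mk D := by
  unfold nodeRep; split_ifs
  · rfl
  · exact mk_rot D
  · rw [mk_rot, mk_rot]

theorem Flat.turn {F : Drawing α → Prop} {D : Drawing α} (h : D.Flat F) : D.turn.Flat F := by
  simpa [Flat, and_comm] using h

theorem Sink.rot {F : Drawing α → Prop} {D : Drawing α} (h : D.Sink F) : D.rot.Sink F := by
  obtain ⟨h1, h2, h3, h4⟩ := h
  exact ⟨by simpa using h1, h3, h4, by simpa using h2⟩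

theorem Flat.edgeRep {F : Drawing α → Prop} {D : Drawing α} (h : D.Flat F) :
    D.edgeRep.Normal F := by
  unfold Drawing.edgeRep
  split_ifs with h1
  · exact Or.inl ⟨h, h1⟩
  · exact Or.inl ⟨h.turn, (isUp_add_three _).2 h1⟩

theorem Sink.nodeRep {F : Drawing α → Prop} {D : Drawing α} (h : D.Sink F) :
    D.nodeRep.Normal F := by
  refine Or.inr ⟨?_, nodeRep_normal h.1⟩
  unfold Drawing.nodeRep
  split_ifs
  · exact h
  · exact h.rot
  · exact h.rot.rot

open Classical in
/-- The normal form found by walking ahead from a drawing with the given front. -/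
noncomputable def seek (F : Drawing α → Prop) : Sub α → ZMod 6 → α → Sub α → Drawing α
  | .leaf, d, a, Z => edgeRep ⟨d, a, .leaf, Z⟩
  | .node b X c Y, d, a, Z =>
    let D : Drawing α := ⟨d, a, .node b X c Y, Z⟩
    if ¬ F D then D.edgeRep
    -- Entering from the left branch, the place is not ahead, so it is on the edge of that branch or
    -- beyond. The direction `d + 4 + 3` is that of a left turn, `d + 1`.
    else if ¬ F D.rot then seek F X (d + 4 + 3) b (.node c Y a Z)
    else if ¬ F D.rot.rot then seek F Y (d + 4 + 4 + 3) c (.node a Z b X)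
    else D.nodeRep

noncomputable def seekAhead (F : Drawing α → Prop) (D : Drawing α) : Drawing α :=
  seek F D.front D.dir D.mark D.back

-- The walk only explores what is ahead, so a traveller with the place behind turns round first.
open Classical in
noncomputable def rep (F : Drawing α → Prop) (D : Drawing α) : Drawing α :=
  if F D.turn then seekAhead F D.turn else seekAhead F D

open Classical in
theorem seekAhead_of_node (F : Drawing α → Prop) {D : Drawing α} (h : D.front.isLeaf = false) :
    seekAhead F D = if ¬ F D then D.edgeRep
      else if ¬ F D.rot then seekAhead F D.rot.turn
      else if ¬ F D.rot.rot then seekAhead F D.rot.rot.turn else D.nodeRep := by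
  obtain ⟨d, a, _ | ⟨b, X, c, Y⟩, Z⟩ := D
  · simp [Sub.isLeaf] at h
  · rfl

theorem seekAhead_of_flat {F : Drawing α → Prop} {D : Drawing α} (h : ¬ F D) :
    seekAhead F D = D.edgeRep := by
  obtain ⟨d, a, _ | ⟨b, X, c, Y⟩, Z⟩ := D
  · rfl
  · rw [seekAhead_of_node F rfl, if_pos h]

theorem mk_seekAhead (F : Drawing α → Prop) (D : Drawing α) : MarkedTree.mk (seekAhead F D) = MarkedTree.mk D := by
  obtain ⟨d, a, X, Z⟩ := D
  induction X generalizing d a Z with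
  | leaf => exact mk_edgeRep _
  | node b X c Y ihX ihY =>
    rw [seekAhead_of_node F rfl]
    split_ifs
    · exact mk_nodeRep _
    · exact (ihY _ _ _).trans ((mk_turn _).trans ((mk_rot _).trans (mk_rot _)))
    · exact (ihX _ _ _).trans ((mk_turn _).trans (mk_rot _))
    · exact mk_edgeRep _

theorem mk_rep (F : Drawing α → Prop) (D : Drawing α) : MarkedTree.mk (rep F D) = MarkedTree.mk D := by
  unfold rep
  split_ifs
  · rw [mk_seekAhead, mk_turn]
  · rw [mk_seekAhead]

theorem rep_of_flat {D : Drawing α} (h : D.Flat F) : rep F D = D.edgeRep := by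
  rw [rep, if_neg h.2, seekAhead_of_flat h.1]

namespace Compass

variable {P F : Drawing α → Prop} (C : Compass P F)
include C

/-- Along the walk the place is never strictly behind; this invariant makes the edge where the walk
stops flat. -/
theorem normal_seekAhead (D : Drawing α) (hP : P D) (h : ¬ F D.turn) :
    (seekAhead F D).Normal F := by
  obtain ⟨d, a, X, Z⟩ := D
  induction X generalizing d a Z with
  | leaf => exact Flat.edgeRep ⟨C.leaf _ hP rfl, h⟩
  | node b X c Y ihX ihY =>
    rw [seekAhead_of_node F rfl]
    split_ifs with h1 h2 h3
    · exact Sink.nodeRep ⟨rfl, h1, h2, h3⟩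
    · refine ihY _ _ _ (C.turn _ (C.rot _ (C.rot _ hP))) ?_
      exact (turn_turn (Drawing.mk d a (.node b X c Y) Z).rot.rot).symm ▸ h3
    · refine ihX _ _ _ (C.turn _ (C.rot _ hP)) ?_
      exact (turn_turn (Drawing.mk d a (.node b X c Y) Z).rot).symm ▸ h2
    · exact Flat.edgeRep ⟨h1, h⟩

theorem normal_rep (D : Drawing α) (hP : P D) : (rep F D).Normal F := by
  unfold rep
  split_ifs with h
  · refine C.normal_seekAhead _ (C.turn _ hP) ?_
    rw [turn_turn]
    exact fun h' => C.asymm D hP h' h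
  · exact C.normal_seekAhead _ hP h

theorem rep_turn (D : Drawing α) (hP : P D) : rep F D.turn = rep F D := by
  by_cases h : F D
  · simp [rep, h, C.asymm D hP h]
  · by_cases h' : F D.turn
    · simp [rep, h, h']
    · simp only [rep, h', turn_turn, h, if_false]
      rw [seekAhead_of_flat h, seekAhead_of_flat h', edgeRep_turn]

-- Here the three edges at the node play the same role: the only edge, if any, from which the place
-- is not ahead is the one to leave by. This makes the invariance under `rot` visible.
open Classical in
theorem rep_of_node (D : Drawing α) (hP : P D) (hD : D.front.isLeaf = false) :
    rep F D = if ¬ F D then seekAhead F D.turn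
      else if ¬ F D.rot then seekAhead F D.rot.turn
      else if ¬ F D.rot.rot then seekAhead F D.rot.rot.turn else D.nodeRep := by
  by_cases h : F D
  · rw [if_neg (not_not.2 h), rep, if_neg (C.asymm D hP h), seekAhead_of_node F hD,
      if_neg (not_not.2 h)]
  · rw [if_pos h, ← C.rep_turn D hP, rep, turn_turn, if_neg h]

theorem rep_rot (D : Drawing α) (hP : P D) : rep F D.rot = rep F D := by
  cases hD : D.front.isLeaf with
  | true =>
    obtain ⟨d, a, _ | ⟨b, X, c, Y⟩, Z⟩ := D
    · rfl
    · simp [Sub.isLeaf] at hD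
  | false =>
    have hD' := (isLeaf_front_rot D).trans hD
    have hD'' := (isLeaf_front_rot D.rot).trans hD'
    rw [C.rep_of_node D hP hD, C.rep_of_node D.rot (C.rot _ hP) hD', rot_rot_rot, nodeRep_rot hD]
    have h0 := C.node D hP hD
    have h1 := C.node D.rot (C.rot _ hP) hD'
    rw [rot_rot_rot] at h1
    -- By `Compass.node` at most one of the three values is false, so both case distinctions select
    -- the same edge.
    by_cases a : F D <;> by_cases b : F D.rot <;> by_cases c : F D.rot.rot <;> simp_all

theorem rep_step {D E : Drawing α} (hP : P D) (h : Step D E) : rep F E = rep F D ∧ P E := by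
  have h1 := C.rot _ hP
  have h2 := C.rot _ h1
  rcases step_iff h with rfl | rfl | rfl
  · exact ⟨C.rep_turn D hP, C.turn _ hP⟩
  · exact ⟨by rw [C.rep_turn _ h1, C.rep_rot _ hP], C.turn _ h1⟩
  · exact ⟨by rw [C.rep_turn _ h2, C.rep_rot _ h1, C.rep_rot _ hP], C.turn _ h2⟩

theorem step_back {D E : Drawing α} (h : Step D E) (hP : P E) : P D := by
  rcases step_iff h with rfl | rfl | rfl
  · simpa using C.turn _ hP
  · simpa using C.rot _ (C.rot _ (C.turn _ hP))
  · simpa using C.rot _ (C.turn _ hP)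

/-- A chain of generating moves may run backwards, so `P` has to be carried along in both
directions. -/
theorem rep_eq {D E : Drawing α} (h : MarkedTree.mk D = MarkedTree.mk E) (hP : P D) :
    rep F D = rep F E := by
  have key : ∀ D E : Drawing α, Relation.EqvGen Step D E →
      (P D ↔ P E) ∧ (P D → rep F D = rep F E) := by
    intro D E h
    induction h with
    | rel x y h => exact ⟨⟨fun p => (C.rep_step p h).2, C.step_back h⟩,
        fun p => (C.rep_step p h).1.symm⟩
    | refl => exact ⟨Iff.rfl, fun _ => rfl⟩
    | symm x y h ih => exact ⟨ih.1.symm, fun p => (ih.2 (ih.1.2 p)).symm⟩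
    | trans x y z h1 h2 ih1 ih2 =>
      exact ⟨ih1.1.trans ih2.1, fun p => (ih1.2 p).trans (ih2.2 (ih1.1.1 p))⟩
  exact (key D E (Quot.eqvGen_exact h)).2 hP

theorem rep_of_sink {D : Drawing α} (hP : P D) (h : D.Sink F) : rep F D = D.nodeRep := by
  rw [C.rep_of_node D hP h.1]
  simp [h.2.1, h.2.2.1, h.2.2.2]

theorem rep_of_normal {D : Drawing α} (hP : P D) (h : D.Normal F) : rep F D = D := by
  rcases h with ⟨h, hd⟩ | ⟨h, hd⟩
  · rw [rep_of_flat h, edgeRep, if_pos hd]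
  · rw [C.rep_of_sink hP h, nodeRep, if_pos hd]

end Compass

end Drawing


/-! ### Heights and the center -/

namespace Sub

variable {α : Type}

/-- The number of prunings that turn a part of a tree into a leaf. -/
def height : Sub α → ℕ
  | leaf => 0
  | node _ l _ r => 1 + max l.height r.height

theorem isLeaf_iff (X : Sub α) : X.isLeaf = true ↔ X.height = 0 := by
  cases X <;> simp [isLeaf, height]

theorem isLeaf_eq (X : Sub α) : X.isLeaf = decide (X.height = 0) := by
  cases X <;> simp [isLeaf, height]

theorem eq_leaf_of_isLeaf {X : Sub α} (h : X.isLeaf = true) : X = leaf := by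
  cases X
  · rfl
  · simp [isLeaf] at h

theorem numNodes_eq_zero (X : Sub α) : X.numNodes = 0 ↔ X.height = 0 := by
  cases X <;> simp [numNodes, height]

theorem numLeaves_eq (X : Sub α) : X.numLeaves = X.numNodes + 1 := by
  induction X with
  | leaf => rfl
  | node a l b r ihl ihr => simp only [numNodes, numLeaves, ihl, ihr]; omega

theorem height_prune (X : Sub α) : X.prune.height = X.height - 1 := by
  induction X with
  | leaf => rfl
  | node a l b r ihl ihr =>
    simp only [prune, isLeaf_eq]
    split_ifs with h
    · simp at h; simp [height, h]
    · simp at h; simp only [height, ihl, ihr]; omega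

end Sub

namespace Drawing

variable {α : Type}

/-- If the place is not ahead, the part behind is at least as high as the part ahead, hence higher
than either branch. Seen from one of these branches, the part behind is contained in what lies
ahead. -/
theorem compass_of_height {O : Type} [LinearOrder O] (h : Sub α → O) (h0 : ∀ X, h .leaf ≤ h X)
    (hl : ∀ a l b r, h l < h (.node a l b r)) (hr : ∀ a l b r, h r < h (.node a l b r)) :
    Compass (fun _ => True) (fun D => h D.back < h D.front) where
  turn _ _ := trivial
  rot _ _ := trivial
  asymm D _ h1 h2 := lt_asymm h1 h2
  leaf D _ h1 h2 := by
    rw [Sub.eq_leaf_of_isLeaf h1] at h2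
    exact not_lt.2 (h0 _) h2
  node D _ h1 h2 := by
    obtain ⟨d, a, _ | ⟨b, X, c, Y⟩, Z⟩ := D
    · simp [Sub.isLeaf] at h1
    · exact ⟨((hl b X c Y).trans_le (not_lt.1 h2)).trans (hr c Y a Z),
        ((hr b X c Y).trans_le (not_lt.1 h2)).trans (hl a Z b X)⟩

/-- The center lies strictly ahead. -/
def CenterAhead (D : Drawing α) : Prop := D.back.height < D.front.height

theorem compass_centerAhead : Compass (fun _ => True) (CenterAhead (α := α)) :=
  compass_of_height Sub.height (fun _ => Nat.zero_le _)
    (fun _ _ _ _ => by simp only [Sub.height]; omega)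
    (fun _ _ _ _ => by simp only [Sub.height]; omega)

theorem flat_centerAhead (D : Drawing α) :
    D.Flat CenterAhead ↔ D.front.height = D.back.height := by
  simp only [Flat, CenterAhead, turn]; omega

/-- The three inequalities together mean that the largest branch height is attained at least twice.
-/
theorem sink_centerAhead (d : ZMod 6) (a b c : α) (X Y Z : Sub α) :
    (Drawing.mk d a (.node b X c Y) Z).Sink CenterAhead ↔
      Z.height ≤ max X.height Y.height ∧ X.height ≤ max Y.height Z.height ∧
        Y.height ≤ max Z.height X.height := by
  simp only [Sink, CenterAhead, rot, Sub.height, Sub.isLeaf, true_and]; omega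

theorem onNakedLeafEdge_iff (D : Drawing α) : D.OnNakedLeafEdge ↔
    (D.back.height = 0 ∧ D.front.leafNeighbors true = 2) ∨
    (D.front.height = 0 ∧ D.back.leafNeighbors true = 2) := by
  simp only [OnNakedLeafEdge, Sub.isLeaf_iff]
  have (X : Sub α) (h : X.height = 0) : X.isLeaf = true := (Sub.isLeaf_iff X).2 h
  constructor
  · rintro (⟨h, h'⟩ | ⟨h, h'⟩) <;> simp_all
  · rintro (⟨h, h'⟩ | ⟨h, h'⟩) <;> simp_all

/-- Pruning lowers both heights by one, truncated at zero. Distinct heights can become equal only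
from `0` and `1`, and then there is a single node and no pruning takes place. -/
theorem isCenterEdge_iff (D : Drawing α) : D.IsCenterEdge ↔ D.front.height = D.back.height := by
  constructor
  · intro h
    induction h with
    | base => rfl
    | prune D h2 hn _ ih =>
      simp only [prune, Sub.height_prune] at ih
      rw [onNakedLeafEdge_iff] at hn
      obtain ⟨d, a, X, Y⟩ := D
      by_contra hne
      have key (X Y : Sub α) (h2 : 2 ≤ X.numNodes + Y.numNodes) (hX : X.height = 0)
          (hY : Y.height = 1) : False := by
        have := (Sub.numNodes_eq_zero X).2 hX
        cases Y with
        | leaf => simp [Sub.height] at hY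
        | node b l c r =>
          simp only [Sub.height] at hY
          have h3 := (Sub.numNodes_eq_zero l).2 (by omega)
          have h4 := (Sub.numNodes_eq_zero r).2 (by omega)
          simp only [Sub.numNodes] at h2
          omega
      simp only [numNodes] at h2 ih hne
      by_cases hX : X.height = 0
      · exact key X Y h2 hX (by omega)
      · exact key Y X (by omega) (by omega) (by omega)
  · intro h
    obtain ⟨d, a, X, Y⟩ := D
    simp only at h
    induction hn : X.height generalizing X Y with
    | zero =>
      rw [Sub.eq_leaf_of_isLeaf ((Sub.isLeaf_iff X).2 hn),
        Sub.eq_leaf_of_isLeaf ((Sub.isLeaf_iff Y).2 (h ▸ hn))]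
      exact .base d a
    | succ n ih =>
      refine .prune _ ?_ ?_ (ih _ _ ?_ ?_)
      · have h1 := mt (Sub.numNodes_eq_zero X).1 (by omega)
        have h2 := mt (Sub.numNodes_eq_zero Y).1 (by omega)
        simp only [numNodes]; omega
      · rw [onNakedLeafEdge_iff]; simp only; omega
      · rw [Sub.height_prune, Sub.height_prune, h]
      · rw [Sub.height_prune, hn]; rfl

theorem isCenterEdge_iff_flat (D : Drawing α) : D.IsCenterEdge ↔ D.Flat CenterAhead := by
  rw [isCenterEdge_iff, flat_centerAhead]

theorem leafNeighbors_eq_two_iff (a b : α) (X Y Z : Sub α) :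
    (Sub.node a X b Y).leafNeighbors Z.isLeaf = 2 ↔
      (X.height = 0 ∧ Y.height = 0 ∧ Z.height ≠ 0) ∨ (X.height = 0 ∧ Y.height ≠ 0 ∧ Z.height = 0) ∨
      (X.height ≠ 0 ∧ Y.height = 0 ∧ Z.height = 0) := by
  simp only [Sub.leafNeighbors, Sub.isLeaf_eq]
  by_cases hX : X.height = 0 <;> by_cases hY : Y.height = 0 <;> by_cases hZ : Z.height = 0 <;>
    simp [hX, hY, hZ]

/-- Truncation at zero creates a new tie for the largest branch height only from heights `0`, `0`,
`1`, that is, at a naked node, which is excluded. -/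
theorem isCenterNode_iff_sink (D : Drawing α) : D.IsCenterNode ↔ D.Sink CenterAhead := by
  constructor
  · intro h
    induction h with
    | base D h1 hl =>
      obtain ⟨d, a, _ | ⟨b, X, c, Y⟩, Z⟩ := D
      · simp [Sub.isLeaf] at hl
      · simp only [numNodes, Sub.numNodes] at h1
        rw [sink_centerAhead]
        have := (Sub.numNodes_eq_zero X).1 (by omega)
        have := (Sub.numNodes_eq_zero Y).1 (by omega)
        have := (Sub.numNodes_eq_zero Z).1 (by omega)
        omega
    | prune D h2 hl hn _ ih =>
      obtain ⟨d, a, _ | ⟨b, X, c, Y⟩, Z⟩ := D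
      · simp [Sub.isLeaf] at hl
      · simp only [prune, Sub.prune] at ih
        simp only [Ne, leafNeighbors_eq_two_iff] at hn
        split_ifs at ih with h
        · exact absurd ih.1 (by simp [Sub.isLeaf])
        · rw [sink_centerAhead] at ih ⊢
          simp only [Sub.height_prune] at ih
          simp only [Sub.isLeaf_eq, Bool.and_eq_true, decide_eq_true_eq] at h
          omega
  · intro h
    obtain ⟨d, a, X, Z⟩ := D
    induction hn : X.height using Nat.strong_induction_on generalizing X Z with
    | _ n ih =>
      by_cases h1 : (Drawing.mk d a X Z).numNodes = 1
      · exact .base _ h1 h.1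
      · cases X with
        | leaf => exact absurd h.1 (by simp [Sub.isLeaf])
        | node b X c Y =>
          rw [sink_centerAhead] at h
          have hX := Sub.numNodes_eq_zero X
          have hY := Sub.numNodes_eq_zero Y
          have hZ := Sub.numNodes_eq_zero Z
          simp only [numNodes, Sub.numNodes] at h1
          simp only [Sub.height] at hn
          have hXY : ¬ (X.isLeaf && Y.isLeaf) = true := by
            simp only [Sub.isLeaf_eq, Bool.and_eq_true, decide_eq_true_eq]
            omega
          refine .prune _ ?_ rfl ?_ ?_
          · simp only [numNodes, Sub.numNodes]; omega
          · simp only [Ne, leafNeighbors_eq_two_iff]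
            omega
          · simp only [Sub.isLeaf_eq, Bool.and_eq_true, decide_eq_true_eq] at hXY
            have hp : (Sub.node b X c Y).prune = .node b X.prune c Y.prune := by
              simp only [Sub.prune, Sub.isLeaf_eq, Bool.and_eq_true, decide_eq_true_eq, if_neg hXY]
            refine ih _ ?_ _ _ ?_ rfl
            · rw [Sub.height_prune]; simp only [Sub.height]; omega
            · simp only [hp]
              rw [sink_centerAhead]
              simp only [Sub.height_prune]
              omega

/-! ### A single marked edge -/

/-- In a tree with a single mark, the mark lies strictly ahead. -/
def MarkAhead (w : α → ℕ) (D : Drawing α) : Prop := 0 < D.front.weight w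

theorem compass_markAhead (w : α → ℕ) :
    Compass (fun D : Drawing α => D.weight w = 1) (MarkAhead w) where
  turn D h := by simp only [weight, turn] at h ⊢; omega
  rot D h := by
    obtain ⟨d, a, _ | ⟨b, X, c, Y⟩, Z⟩ := D
    · exact h
    · simp only [weight, rot, Sub.weight] at h ⊢; omega
  asymm D h h1 h2 := by simp only [weight, MarkAhead, turn] at h h1 h2; omega
  leaf D h h1 h2 := by
    rw [MarkAhead, Sub.eq_leaf_of_isLeaf h1] at h2
    exact lt_irrefl _ h2
  node D h h1 h2 := by
    obtain ⟨d, a, _ | ⟨b, X, c, Y⟩, Z⟩ := D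
    · simp [Sub.isLeaf] at h1
    · simp only [weight, MarkAhead, rot, Sub.weight] at h h2 ⊢; omega

theorem normal_markAhead (w : α → ℕ) (D : Drawing α) (h : D.weight w = 1) :
    D.Normal (MarkAhead w) ↔
      D.front.weight w = 0 ∧ D.back.weight w = 0 ∧ IsUp D.dir := by
  constructor
  · rintro (⟨⟨h1, h2⟩, h3⟩ | ⟨⟨h1, h2, h3, h4⟩, -⟩)
    · simp only [MarkAhead, turn] at h1 h2
      exact ⟨by omega, by omega, h3⟩
    · obtain ⟨d, a, _ | ⟨b, X, c, Y⟩, Z⟩ := D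
      · simp [Sub.isLeaf] at h1
      · simp only [weight, MarkAhead, rot, Sub.weight] at h h2 h3 h4; omega
  · rintro ⟨h1, h2, h3⟩
    refine Or.inl ⟨⟨?_, ?_⟩, h3⟩ <;> simp only [MarkAhead, turn] <;> omega

/-! ### Conditions on all edges of a tree -/

/-- `p` holds for the drawings on all edges strictly ahead, seen travelling away. -/
def Ahead (p : Drawing α → Prop) : Sub α → ZMod 6 → α → Sub α → Prop
  | .leaf, _, _, _ => True
  | .node b X c Y, d, a, Z =>
    let D : Drawing α := ⟨d, a, .node b X c Y, Z⟩
    (p D.rot ∧ Ahead p X (d + 4 + 3) b (.node c Y a Z)) ∧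
      (p D.rot.rot ∧ Ahead p Y (d + 4 + 4 + 3) c (.node a Z b X))

def AllAhead (p : Drawing α → Prop) (D : Drawing α) : Prop :=
  Ahead p D.front D.dir D.mark D.back

theorem allAhead_of_node (p : Drawing α → Prop) {D : Drawing α} (h : D.front.isLeaf = false) :
    AllAhead p D ↔ (p D.rot ∧ AllAhead p D.rot.turn) ∧
      (p D.rot.rot ∧ AllAhead p D.rot.rot.turn) := by
  obtain ⟨d, a, _ | ⟨b, X, c, Y⟩, Z⟩ := D
  · simp [Sub.isLeaf] at h
  · rfl

def Everywhere (p : Drawing α → Prop) (D : Drawing α) : Prop :=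
  p D ∧ AllAhead p D ∧ AllAhead p D.turn

theorem everywhere_turn {p : Drawing α → Prop} (hp : ∀ D, p D.turn ↔ p D) (D : Drawing α) :
    Everywhere p D.turn ↔ Everywhere p D := by
  simp only [Everywhere, hp, turn_turn]; tauto

theorem everywhere_rot {p : Drawing α → Prop} (D : Drawing α) :
    Everywhere p D.rot ↔ Everywhere p D := by
  cases hD : D.front.isLeaf with
  | true =>
    obtain ⟨d, a, _ | ⟨b, X, c, Y⟩, Z⟩ := D
    · rfl
    · simp [Sub.isLeaf] at hD
  | false =>
    rw [Everywhere, Everywhere, allAhead_of_node p hD,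
      allAhead_of_node p ((isLeaf_front_rot D).trans hD), rot_rot_rot]
    tauto

/-- `Everywhere` meets each edge from one traveller only, which suffices as `p` is symmetric; it is
itself invariant under the moves. -/
theorem forall_mk_iff {p : Drawing α → Prop} (hp : ∀ D, p D.turn ↔ p D) (D : Drawing α) :
    (∀ E, MarkedTree.mk E = MarkedTree.mk D → p E) ↔ Everywhere p D := by
  constructor
  · intro h
    have key : ∀ (X : Sub α) (d : ZMod 6) (a : α) (Z : Sub α),
        MarkedTree.mk ⟨d, a, X, Z⟩ = MarkedTree.mk D → AllAhead p ⟨d, a, X, Z⟩ := by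
      intro X
      induction X with
      | leaf => exact fun _ _ _ _ => trivial
      | node b X c Y ihX ihY =>
        intro d a Z hE
        rw [allAhead_of_node p rfl]
        exact ⟨⟨h _ ((mk_rot _).trans hE), ihX _ _ _
            ((mk_turn _).trans ((mk_rot _).trans hE))⟩,
          h _ (by rw [mk_rot, mk_rot, hE]), ihY _ _ _
            ((mk_turn _).trans ((mk_rot _).trans ((mk_rot _).trans hE)))⟩
    exact ⟨h D rfl, key _ _ _ _ rfl, key _ _ _ _ (mk_turn D)⟩
  · intro h E hE
    have key : ∀ D E : Drawing α, Relation.EqvGen Step D E → (Everywhere p D ↔ Everywhere p E) := by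
      intro D E h
      induction h with
      | rel x y h =>
        rcases step_iff h with rfl | rfl | rfl <;>
          simp only [everywhere_turn hp, everywhere_rot]
      | refl => rfl
      | symm x y _ ih => exact ih.symm
      | trans x y z _ _ ih1 ih2 => exact ih1.trans ih2
    exact ((key E D (Quot.eqvGen_exact hE)).2 h).1

end Drawing


/-! ### Well-labelled configurations seen from the center -/

/-- All strips beyond are labelled with `L`/`R` only. -/
def Sub.Plain : Sub Strip → Prop
  | .leaf => True
  | .node a l b r => (¬ a.IsTweaked ∧ l.Plain) ∧ (¬ b.IsTweaked ∧ r.Plain)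

theorem Strip.length_sides {a : Strip} (h : ¬ a.IsTweaked) : a.sides.length = a.length := by
  cases a
  · rfl
  · exact absurd trivial h

theorem Strip.plain_sides {a : Strip} (h : ¬ a.IsTweaked) : Strip.plain a.sides = a := by
  cases a
  · rfl
  · exact absurd trivial h

namespace Drawing

/-- The labelling condition at the traveller's edge. -/
def MarkOK (D : Drawing Strip) : Prop :=
  D.mark.IsTweaked ↔ D.IsCenterEdge ∧ Odd D.mark.length

theorem markOK_turn (D : Drawing Strip) : D.turn.MarkOK ↔ D.MarkOK := by
  simp only [MarkOK, isCenterEdge_iff, turn, eq_comm]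

theorem markOK_of_not_flat {D : Drawing Strip} (h : D.front.height ≠ D.back.height) :
    D.MarkOK ↔ ¬ D.mark.IsTweaked := by
  simp only [MarkOK, isCenterEdge_iff, h, false_and, iff_false]

/-- When the part behind is at least as high, every later edge has a strictly lower part ahead than
behind. It is therefore not the center, and its strip must be plain. -/
theorem allAhead_markOK (X : Sub Strip) (d : ZMod 6) (a : Strip) (Z : Sub Strip)
    (h : X.height ≤ Z.height) : AllAhead MarkOK ⟨d, a, X, Z⟩ ↔ X.Plain := by
  induction X generalizing d a Z with
  | leaf => exact Iff.rfl
  | node b X c Y ihX ihY =>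
    rw [allAhead_of_node _ rfl, Sub.Plain]
    simp only [Sub.height] at h
    refine and_congr (and_congr (markOK_of_not_flat ?_) (ihX _ _ _ ?_))
      (and_congr (markOK_of_not_flat ?_) (ihY _ _ _ ?_)) <;> simp only [rot, Sub.height] <;> omega

theorem wellLabelled_mk_iff (D : Drawing Strip) :
    WellLabelled (MarkedTree.mk D) ↔ Everywhere MarkOK D :=
  forall_mk_iff markOK_turn D

theorem wellLabelled_flat {d : ZMod 6} {a : Strip} {X Y : Sub Strip} (h : X.height = Y.height) :
    WellLabelled (MarkedTree.mk ⟨d, a, X, Y⟩) ↔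
      (a.IsTweaked ↔ Odd a.length) ∧ X.Plain ∧ Y.Plain := by
  rw [wellLabelled_mk_iff]
  refine and_congr ?_ (and_congr (allAhead_markOK _ _ _ _ h.le) (allAhead_markOK _ _ _ _ h.ge))
  simp only [MarkOK, isCenterEdge_iff, h, true_and]

theorem wellLabelled_sink {D : Drawing Strip} (h : D.Sink CenterAhead) :
    WellLabelled (MarkedTree.mk D) ↔ ¬ D.mark.IsTweaked ∧ D.front.Plain ∧ D.back.Plain := by
  obtain ⟨d, a, _ | ⟨b, X, c, Y⟩, Z⟩ := D
  · exact absurd h.1 (by simp [Sub.isLeaf])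
  rw [sink_centerAhead] at h
  rw [wellLabelled_mk_iff]
  refine and_congr (markOK_of_not_flat ?_) (and_congr ?_ (allAhead_markOK _ _ _ _ ?_))
  · simp only [Sub.height]; omega
  · rw [allAhead_of_node _ rfl, Sub.Plain]
    refine and_congr (and_congr (markOK_of_not_flat ?_) (allAhead_markOK _ _ _ _ ?_))
      (and_congr (markOK_of_not_flat ?_) (allAhead_markOK _ _ _ _ ?_)) <;>
      simp only [rot, Sub.height] <;> omega
  · simp only [Sub.height]; omega

end Drawing

@[simp] theorem Sub.isLeaf_leaf {α : Type} : (leaf : Sub α).isLeaf = true := rfl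

@[simp] theorem Sub.isLeaf_node {α : Type} (a : α) (l : Sub α) (b : α) (r : Sub α) :
    (node a l b r).isLeaf = false := rfl

/-! ### The skeleton of a tree: hidden nodes, and naked nodes as leaves -/

/-- The height of the skeleton, plus one. -/
def Sub.skelHeight : Sub Unit → ℕ
  | .leaf => 0
  | .node _ l _ r =>
    if l.isLeaf then if r.isLeaf then 1 else r.skelHeight
    else if r.isLeaf then l.skelHeight else 1 + max l.skelHeight r.skelHeight

/-- The number of exposed nodes passed before the first naked or hidden node. -/
def Sub.stem : Sub Unit → ℕ
  | .leaf => 0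
  | .node _ l _ r =>
    if l.isLeaf then if r.isLeaf then 0 else r.stem + 1
    else if r.isLeaf then l.stem + 1 else 0

/-- Lexicographic, so that the stem breaks ties of skeleton height: on the strip of a center edge,
the place with equal values on both sides is the middle of the strip. -/
def Sub.skel (X : Sub Unit) : ℕ ×ₗ ℕ := toLex (X.skelHeight, X.stem)

theorem Sub.skel_lt_iff {X Y : Sub Unit} : X.skel < Y.skel ↔
    X.skelHeight < Y.skelHeight ∨ X.skelHeight = Y.skelHeight ∧ X.stem < Y.stem :=
  Prod.Lex.toLex_lt_toLex

theorem Sub.skelHeight_eq_zero (X : Sub Unit) : X.skelHeight = 0 ↔ X.isLeaf = true := by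
  induction X with
  | leaf => simp [skelHeight, isLeaf]
  | node a l b r ihl ihr =>
    simp only [skelHeight]
    split_ifs with h1 h2 h3 <;> simp_all [isLeaf]

theorem Sub.stem_of_isLeaf {X : Sub Unit} (h : X.isLeaf = true) : X.stem = 0 := by
  rw [eq_leaf_of_isLeaf h]; rfl

namespace Drawing

def SkelAhead (D : Drawing Unit) : Prop := D.back.skel < D.front.skel

/-- Compared with a branch that is not a leaf, an exposed node keeps the skeleton height and adds
one to the stem, and a hidden node raises the skeleton height. Leaves alone have skeleton height
`0`. -/
theorem compass_skelAhead : Compass (fun _ => True) SkelAhead := by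
  refine compass_of_height Sub.skel (fun X => ?_) (fun _ l _ r => ?_) (fun _ l _ r => ?_)
  · rw [← not_lt, Sub.skel_lt_iff]; simp only [Sub.skelHeight, Sub.stem]; omega
  all_goals
    have hl := Sub.skelHeight_eq_zero l
    have hr := Sub.skelHeight_eq_zero r
    rw [Sub.skel_lt_iff]
    simp only [Sub.skelHeight, Sub.stem]
    have h1 := Sub.stem_of_isLeaf (X := l)
    have h2 := Sub.stem_of_isLeaf (X := r)
    cases h3 : l.isLeaf <;> cases h4 : r.isLeaf <;> simp_all
  all_goals omega

end Drawing

/-! ### Inserting strips and reading them off -/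

theorem hang_append (s : List Side) (x : Side) (X : Sub Unit) :
    hang (s ++ [x]) X = insertNode (hang s X) x := by
  simp [hang]

@[simp] theorem isLeaf_insertNode (X : Sub Unit) (x : Side) : (insertNode X x).isLeaf = false := by
  cases x <;> rfl

theorem isLeaf_hang {X : Sub Unit} (h : X.isLeaf = false) (s : List Side) :
    (hang s X).isLeaf = false := by
  induction s using List.reverseRecOn with
  | nil => exact h
  | append_singleton s x ih => rw [hang_append]; simp

@[simp] theorem isLeaf_expand (C : Sub Strip) : (expand C).isLeaf = false := by
  cases C <;> rfl

@[simp] theorem isLeaf_hang_expand (s : List Side) (C : Sub Strip) :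
    (hang s (expand C)).isLeaf = false := isLeaf_hang (isLeaf_expand C) s

theorem skelHeight_hang {X : Sub Unit} (h : X.isLeaf = false) (s : List Side) :
    (hang s X).skelHeight = X.skelHeight := by
  induction s using List.reverseRecOn with
  | nil => rfl
  | append_singleton s x ih =>
    rw [hang_append, ← ih]
    cases x <;> simp [insertNode, Sub.skelHeight, isLeaf_hang h]

theorem stem_hang {X : Sub Unit} (h : X.isLeaf = false) (s : List Side) :
    (hang s X).stem = X.stem + s.length := by
  induction s using List.reverseRecOn with
  | nil => rfl
  | append_singleton s x ih =>
    rw [hang_append, List.length_append, ← add_assoc, ← ih]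
    cases x <;> simp [insertNode, Sub.stem, isLeaf_hang h]

theorem skelHeight_expand (C : Sub Strip) : (expand C).skelHeight = C.height + 1 := by
  induction C with
  | leaf => rfl
  | node a l b r ihl ihr =>
    simp [expand, Sub.skelHeight, Sub.height, skelHeight_hang, ihl, ihr]; omega

theorem stem_expand (C : Sub Strip) : (expand C).stem = 0 := by
  cases C
  · rfl
  · simp [expand, Sub.stem]

@[simp] theorem skelHeight_hang_expand (s : List Side) (C : Sub Strip) :
    (hang s (expand C)).skelHeight = C.height + 1 := by
  rw [skelHeight_hang (isLeaf_expand C), skelHeight_expand]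

@[simp] theorem stem_hang_expand (s : List Side) (C : Sub Strip) :
    (hang s (expand C)).stem = s.length := by
  rw [stem_hang (isLeaf_expand C), stem_expand, zero_add]

/-- The strip on the edge leading to a part of a tree, and the part of the configuration beyond. -/
def contract : Sub Unit → List Side × Sub Strip
  | .leaf => ([], .leaf)
  | .node _ l _ r =>
    if l.isLeaf then
      -- The node met first is the nearest to the center, so its label goes last.
      if r.isLeaf then ([], .leaf) else ((contract r).1 ++ [.L], (contract r).2)
    else
      if r.isLeaf then ((contract l).1 ++ [.R], (contract l).2)
      else ([], .node (.plain (contract l).1) (contract l).2 (.plain (contract r).1) (contract r).2)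

theorem contract_hang {X : Sub Unit} (h : X.isLeaf = false) (s : List Side) :
    contract (hang s X) = ((contract X).1 ++ s, (contract X).2) := by
  induction s using List.reverseRecOn with
  | nil => simp [hang]
  | append_singleton s x ih =>
    rw [hang_append]
    cases x <;> simp [insertNode, contract, isLeaf_hang h, ih]

/-- `expand` sees only `sides`, and `contract` returns plain strips; a `T`/`B` label away from the
center would be lost. -/
theorem contract_expand {C : Sub Strip} (h : C.Plain) : contract (expand C) = ([], C) := by
  induction C with
  | leaf => rfl
  | node a l b r ihl ihr =>
    obtain ⟨⟨h1, h2⟩, h3, h4⟩ := h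
    simp [expand, contract, contract_hang, ihl h2, ihr h4, Strip.plain_sides h1,
      Strip.plain_sides h3]

theorem contract_hang_expand {C : Sub Strip} (h : C.Plain) (s : List Side) :
    contract (hang s (expand C)) = (s, C) := by
  rw [contract_hang (isLeaf_expand C), contract_expand h, List.nil_append]

theorem hang_contract {X : Sub Unit} (h : X.isLeaf = false) :
    hang (contract X).1 (expand (contract X).2) = X := by
  induction X with
  | leaf => simp [Sub.isLeaf] at h
  | node a l b r ihl ihr =>
    simp only [contract]
    split_ifs with h1 h2 h2
    · rw [Sub.eq_leaf_of_isLeaf h1, Sub.eq_leaf_of_isLeaf h2]; rfl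
    · rw [hang_append, ihr (by simpa using h2), Sub.eq_leaf_of_isLeaf h1]; rfl
    · rw [hang_append, ihl (by simpa using h1), Sub.eq_leaf_of_isLeaf h2]; rfl
    · simp only [expand, Strip.sides, ihl (by simpa using h1), ihr (by simpa using h2)]; rfl

theorem plain_contract (X : Sub Unit) : (contract X).2.Plain := by
  induction X with
  | leaf => trivial
  | node a l b r ihl ihr =>
    simp only [contract]
    split_ifs
    · trivial
    · exact ihr
    · exact ihl
    · exact ⟨⟨id, ihl⟩, id, ihr⟩

theorem skelHeight_eq {X : Sub Unit} (h : X.isLeaf = false) :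
    X.skelHeight = (contract X).2.height + 1 := by
  conv_lhs => rw [← hang_contract h, skelHeight_hang_expand]

theorem stem_eq {X : Sub Unit} (h : X.isLeaf = false) :
    X.stem = (contract X).1.length := by
  conv_lhs => rw [← hang_contract h, stem_hang_expand]

/-! ### Node counts of the constructed tree -/

theorem numNodes_hang (s : List Side) (X : Sub Unit) :
    (hang s X).numNodes = s.length + X.numNodes := by
  induction s using List.reverseRecOn with
  | nil => simp [hang]
  | append_singleton s x ih =>
    rw [hang_append, List.length_append]
    cases x <;> simp [insertNode, Sub.numNodes, ih] <;> omega

theorem nodesWith_hang {X : Sub Unit} (h : X.isLeaf = false) (j : ℕ) (s : List Side) :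
    (hang s X).nodesWith j false = (if 1 = j then s.length else 0) + X.nodesWith j false := by
  induction s using List.reverseRecOn with
  | nil => simp [hang]
  | append_singleton s x ih =>
    rw [hang_append, List.length_append]
    by_cases hj : 1 = j <;> cases x <;>
      simp [insertNode, Sub.nodesWith, Sub.leafNeighbors, isLeaf_hang h, ih, hj] <;> omega

theorem numNodes_expand {C : Sub Strip} (h : C.Plain) :
    (expand C).numNodes = C.numLeaves + C.numNodes + C.weight Strip.length := by
  induction C with
  | leaf => rfl
  | node a l b r ihl ihr =>
    obtain ⟨⟨h1, h2⟩, h3, h4⟩ := h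
    simp only [expand, Sub.numNodes, numNodes_hang, ihl h2, ihr h4, Strip.length_sides h1,
      Strip.length_sides h3, Sub.weight, Sub.numLeaves]
    omega

theorem nodesWith_expand {C : Sub Strip} (h : C.Plain) (j : ℕ) :
    (expand C).nodesWith j false = (if 0 = j then C.numNodes else 0) +
      (if 1 = j then C.weight Strip.length else 0) + (if 2 = j then C.numLeaves else 0) := by
  induction C with
  | leaf => simp [expand, Sub.nodesWith, Sub.leafNeighbors, Sub.isLeaf, Sub.numNodes, Sub.weight,
      Sub.numLeaves]
  | node a l b r ihl ihr =>
    obtain ⟨⟨h1, h2⟩, h3, h4⟩ := h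
    simp only [expand, Sub.nodesWith, nodesWith_hang, isLeaf_expand, Sub.leafNeighbors,
      isLeaf_hang_expand, ihl h2, ihr h4, Strip.length_sides h1,
      Strip.length_sides h3, Sub.weight, Sub.numLeaves, Sub.numNodes, Bool.toNat_false, add_zero]
    split_ifs <;> omega


open Drawing

theorem nodesWith_hang_expand {C : Sub Strip} (h : C.Plain) (s : List Side) (j : ℕ) :
    (hang s (expand C)).nodesWith j false = (if 0 = j then C.numNodes else 0) +
      (if 1 = j then s.length + C.weight Strip.length else 0) +
      (if 2 = j then C.numLeaves else 0) := by
  rw [nodesWith_hang (isLeaf_expand C), nodesWith_expand h]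
  split_ifs <;> omega

theorem mk_nodesWith {α : Type} (D : Drawing α) (j : ℕ) :
    (MarkedTree.mk D).nodesWith j = D.nodesWith j := rfl

theorem mk_numNodes {α : Type} (D : Drawing α) : (MarkedTree.mk D).numNodes = D.numNodes := rfl

theorem mk_numLeaves {α : Type} (D : Drawing α) : (MarkedTree.mk D).numLeaves = D.numLeaves := rfl

theorem mk_weight {α : Type} (w : α → ℕ) (D : Drawing α) :
    (MarkedTree.mk D).weight w = D.weight w := rfl

/-- Expanded branches are never leaves, so each node sees only the leaves put there by the
construction. For an odd center strip the node next to the new leaf is exposed and accounts for the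
`T`/`B` square. The total uses that a tree has two more leaves than nodes. -/
theorem Produces.numbers {c : MarkedTree Strip} {t : MarkedTree Unit} (h : Produces c t)
    (hc : WellLabelled c) :
    (∀ j, t.nodesWith j = (if 0 = j then c.numNodes else 0) +
      (if 1 = j then c.weight Strip.length else 0) + (if 2 = j then c.numLeaves else 0)) ∧
    t.numNodes = c.weight Strip.length + (2 + 2 * c.numNodes) := by
  cases h with
  | node d a b c X Y Z hD =>
    rw [isCenterNode_iff_sink] at hD
    obtain ⟨ha, ⟨⟨hb, hX⟩, hc, hY⟩, hZ⟩ := (wellLabelled_sink hD).1 hc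
    simp only at ha hb hc hX hY hZ
    refine ⟨fun j => ?_, ?_⟩
    · simp only [mk_nodesWith, mk_numNodes, mk_weight, mk_numLeaves, Drawing.nodesWith,
        Drawing.numNodes, Drawing.weight, Drawing.numLeaves, Sub.nodesWith, Sub.leafNeighbors,
        isLeaf_hang_expand, Sub.isLeaf_node, nodesWith_hang_expand hX, nodesWith_hang_expand hY,
        nodesWith_hang_expand hZ, Strip.length_sides ha, Strip.length_sides hb,
        Strip.length_sides hc, Sub.numNodes, Sub.weight, Sub.numLeaves, Bool.toNat_false, add_zero]
      split_ifs <;> omega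
    · simp only [mk_numNodes, mk_weight, Drawing.numNodes, Drawing.weight, Sub.numNodes,
        numNodes_hang, numNodes_expand hX, numNodes_expand hY, numNodes_expand hZ, Sub.weight,
        Strip.length_sides ha, Strip.length_sides hb, Strip.length_sides hc, Sub.numLeaves_eq]
      omega
  | even d s m X Y hd hD hs =>
    rw [isCenterEdge_iff] at hD
    obtain ⟨-, hX, hY⟩ := (wellLabelled_flat hD).1 hc
    refine ⟨fun j => ?_, ?_⟩
    · simp only [mk_nodesWith, mk_numNodes, mk_weight, mk_numLeaves, Drawing.nodesWith,
        Drawing.numNodes, Drawing.weight, Drawing.numLeaves, isLeaf_hang_expand,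
        nodesWith_hang_expand hX, nodesWith_hang_expand hY, List.length_reverse, List.length_drop,
        List.length_take, Strip.length]
      split_ifs <;> omega
    · simp only [mk_numNodes, mk_weight, Drawing.numNodes, Drawing.weight, numNodes_hang,
        numNodes_expand hX, numNodes_expand hY, Sub.numLeaves_eq, List.length_reverse,
        List.length_drop, List.length_take, Strip.length]
      omega
  | bottom d s m X Y hd hD hs | top d s m X Y hd hD hs =>
    rw [isCenterEdge_iff] at hD
    obtain ⟨-, hX, hY⟩ := (wellLabelled_flat hD).1 hc
    refine ⟨fun j => ?_, ?_⟩
    · simp only [mk_nodesWith, mk_numNodes, mk_weight, mk_numLeaves, Drawing.nodesWith,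
        Drawing.numNodes, Drawing.weight, Drawing.numLeaves, isLeaf_hang_expand, Sub.nodesWith,
        Sub.leafNeighbors, Sub.isLeaf_leaf, Bool.toNat_false, Bool.toNat_true,
        nodesWith_hang_expand hX, nodesWith_hang_expand hY, List.length_reverse, List.length_drop,
        List.length_take, Strip.length]
      split_ifs <;> omega
    · simp only [mk_numNodes, mk_weight, Drawing.numNodes, Drawing.weight, numNodes_hang,
        numNodes_expand hX, numNodes_expand hY, Sub.numLeaves_eq, List.length_reverse,
        List.length_drop, List.length_take, Strip.length, Sub.numNodes]
      omega

/-! ### The construction as a function -/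

/-- The tree rooted at a leaf that arises from a center edge with an odd number of squares. -/
def oddTree (d : ZMod 6) (s : List Side) (X Y : Sub Strip) : MarkedTree Unit :=
  .mk ⟨d, (), .node () (hang (s.take (s.length / 2)) (expand Y)) ()
    (hang (s.drop (s.length / 2)).reverse (expand X)), .leaf⟩

def evenTree (d : ZMod 6) (s : List Side) (X Y : Sub Strip) : MarkedTree Unit :=
  .mk ⟨d, (), hang (s.drop (s.length / 2)).reverse (expand X),
    hang (s.take (s.length / 2)) (expand Y)⟩

/-- The value at a leaf is a dummy: a center node is never a leaf. -/
def nodeTree : Drawing Strip → MarkedTree Unit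
  | ⟨d, a, .node b X c Y, Z⟩ =>
    .mk ⟨d, (), .node () (hang b.sides (expand X)) () (hang c.sides (expand Y)),
      hang a.sides (expand Z)⟩
  | ⟨d, _, .leaf, _⟩ => .mk ⟨d, (), .leaf, .leaf⟩

/-- The tree obtained from a configuration seen at its center. -/
def build (D : Drawing Strip) : MarkedTree Unit :=
  if D.front.height = D.back.height then
    match D.mark with
    | .plain s => evenTree D.dir s D.front D.back
    | .tweaked .B s => oddTree D.dir s D.front D.back
    | .tweaked .T s => oddTree (D.dir + 3) s D.back D.front
  else nodeTree D

theorem nodeTree_rot (D : Drawing Strip) : nodeTree D.rot = nodeTree D := by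
  obtain ⟨d, a, _ | ⟨b, X, c, Y⟩, Z⟩ := D
  · rfl
  · exact mk_rot (Drawing.mk d () (.node () (hang b.sides (expand X)) ()
      (hang c.sides (expand Y))) (hang a.sides (expand Z)))

theorem build_of_sink {D : Drawing Strip} (h : D.Sink CenterAhead) : build D = nodeTree D := by
  have := h.2.1
  rw [CenterAhead] at this
  rw [build, if_neg (by omega)]

theorem build_nodeRep {D : Drawing Strip} (h : D.Sink CenterAhead) :
    build D.nodeRep = nodeTree D := by
  unfold nodeRep
  split_ifs
  · exact build_of_sink h
  · rw [build_of_sink h.rot, nodeTree_rot]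
  · rw [build_of_sink h.rot.rot, nodeTree_rot, nodeTree_rot]

/-- A center node may be entered by any of its three edges; invariance of `nodeTree` under `rot`
allows passing to the normal entrance. -/
theorem Produces.eq_build {c : MarkedTree Strip} {t : MarkedTree Unit} (h : Produces c t) :
    ∃ D : Drawing Strip, .mk D = c ∧ D.Normal CenterAhead ∧ build D = t := by
  cases h with
  | node d a b c X Y Z hD =>
    rw [isCenterNode_iff_sink] at hD
    exact ⟨_, mk_nodeRep _, hD.nodeRep, build_nodeRep hD⟩
  | even d s m X Y hd hD hs | bottom d s m X Y hd hD hs | top d s m X Y hd hD hs =>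
    obtain rfl : s.length / 2 = m := by omega
    refine ⟨_, rfl, Or.inl ⟨(isCenterEdge_iff_flat _).1 hD, hd⟩, ?_⟩
    rw [isCenterEdge_iff] at hD
    rw [build, if_pos hD]
    rfl

theorem Produces.unique {c : MarkedTree Strip} {t t' : MarkedTree Unit} (h : Produces c t)
    (h' : Produces c t') : t = t' := by
  obtain ⟨D, rfl, hD, rfl⟩ := h.eq_build
  obtain ⟨D', h1, hD', rfl⟩ := h'.eq_build
  rw [← compass_centerAhead.rep_of_normal trivial hD, ← compass_centerAhead.rep_eq h1 trivial,
    compass_centerAhead.rep_of_normal trivial hD']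

/-- On a center edge, well-labelledness ties the kind of strip to the parity of its length, so the
remaining `L`/`R` labels can be halved. -/
theorem Produces.exists {c : MarkedTree Strip} (hc : WellLabelled c) : ∃ t, Produces c t := by
  induction c using Quot.ind with
  | mk D =>
  have h1 := compass_centerAhead.normal_rep D trivial
  rw [show Quot.mk _ D = MarkedTree.mk D from rfl, ← mk_rep CenterAhead] at hc ⊢
  generalize rep CenterAhead D = E at *
  obtain ⟨d, a, X, Z⟩ := E
  rcases h1 with ⟨h1, hd⟩ | ⟨h1, -⟩
  · have hE := h1
    rw [← isCenterEdge_iff_flat] at hE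
    rw [flat_centerAhead] at h1
    obtain ⟨ha, -, -⟩ := (wellLabelled_flat h1).1 hc
    cases a with
    | plain s =>
      simp only [Strip.IsTweaked, Strip.length, false_iff, Nat.not_odd_iff_even] at ha
      obtain ⟨m, hm⟩ := ha
      exact ⟨_, .even d s m X Z hd hE (by omega)⟩
    | tweaked v s =>
      simp only [Strip.IsTweaked, Strip.length, true_iff] at ha
      obtain ⟨m, hm⟩ := ha
      cases v
      · exact ⟨_, .top d s m X Z hd hE (by omega)⟩
      · exact ⟨_, .bottom d s m X Z hd hE (by omega)⟩
  · cases X with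
    | leaf => exact absurd h1.1 (by simp)
    | node b X c Y =>
      rw [← isCenterNode_iff_sink] at h1
      exact ⟨_, .node d a b c X Y Z h1⟩

/-! ### The inverse of the construction -/

/-- If the edge from the leaf goes up, the leaf took the bottom vertex, hence `B`; otherwise the
edge is turned and the label is `T`. Labels of `Y` are reversed because `contract` lists them from
far to near, whereas the strip runs from the end of `X` to the end of `Y`. -/
def oddConfig (d : ZMod 6) (X Y : Sub Unit) : MarkedTree Strip :=
  if IsUp d then
    .mk ⟨d, .tweaked .B ((contract X).1 ++ (contract Y).1.reverse), (contract Y).2, (contract X).2⟩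
  else
    .mk ⟨d + 3, .tweaked .T ((contract X).1 ++ (contract Y).1.reverse), (contract X).2,
      (contract Y).2⟩

/-- The configuration of a tree seen at the center of its skeleton. -/
def unbuild : Drawing Unit → MarkedTree Strip
  | ⟨d, _, X, Z⟩ =>
    if X.skel = Z.skel then
      .mk ⟨d, .plain ((contract Z).1 ++ (contract X).1.reverse), (contract X).2, (contract Z).2⟩
    else
      match X with
      | .leaf => .mk ⟨d, .plain [], .leaf, .leaf⟩
      | .node _ X _ Y =>
        if Z.isLeaf then oddConfig d X Y
        else if X.isLeaf then oddConfig (d + 4) Y Z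
        else if Y.isLeaf then oddConfig (d + 4 + 4) Z X
        else .mk ⟨d, .plain (contract Z).1, .node (.plain (contract X).1) (contract X).2
          (.plain (contract Y).1) (contract Y).2, (contract Z).2⟩

/-- At most one of the three branches at the node ahead of the traveller is a leaf. -/
def FewLeaves : Drawing Unit → Prop
  | ⟨_, _, .leaf, _⟩ => False
  | ⟨_, _, .node _ X _ Y, Z⟩ => (X.isLeaf = false ∧ Y.isLeaf = false) ∨
      (Y.isLeaf = false ∧ Z.isLeaf = false) ∨ (Z.isLeaf = false ∧ X.isLeaf = false)

theorem FewLeaves.rot {D : Drawing Unit} (h : FewLeaves D) : FewLeaves D.rot := by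
  obtain ⟨d, a, _ | ⟨b, X, c, Y⟩, Z⟩ := D
  · exact h
  · simp only [FewLeaves, Drawing.rot] at h ⊢; tauto

/-- With two leaves at the node, the order of tests in `unbuild` could matter; `FewLeaves` excludes
this. -/
theorem unbuild_rot {D : Drawing Unit} (h : D.Sink SkelAhead) (h' : FewLeaves D) :
    unbuild D.rot = unbuild D := by
  obtain ⟨d, a, _ | ⟨b, X, c, Y⟩, Z⟩ := D
  · exact absurd h.1 (by simp)
  have h1 := h.2.1.ne'
  have h2 := h.2.2.1.ne'
  have h3 : d + 4 + 4 + 4 = d := by clear h h' h1 h2; revert d; decide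
  simp only [Drawing.rot] at h1 h2
  simp only [unbuild, Drawing.rot, if_neg h1, if_neg h2, h3]
  cases hX : X.isLeaf <;> cases hY : Y.isLeaf <;> cases hZ : Z.isLeaf <;>
    simp only [FewLeaves, hX, hY, hZ, if_true, if_false, Bool.false_eq_true, Bool.true_eq_false,
      and_false, false_and, or_false] at h' ⊢
  · exact mk_rot (Drawing.mk d (.plain (contract Z).1) (.node (.plain (contract X).1) (contract X).2
      (.plain (contract Y).1) (contract Y).2) (contract Z).2)

theorem unbuild_nodeRep {D : Drawing Unit} (h : D.Sink SkelAhead) (h' : FewLeaves D) :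
    unbuild D.nodeRep = unbuild D := by
  unfold nodeRep
  split_ifs
  · rfl
  · exact unbuild_rot h h'
  · rw [unbuild_rot h.rot h'.rot, unbuild_rot h h']

theorem flat_skelAhead (D : Drawing Unit) : D.Flat SkelAhead ↔ D.front.skel = D.back.skel := by
  simp only [Flat, SkelAhead, turn, not_lt]
  exact ⟨fun h => le_antisymm h.1 h.2, fun h => ⟨h.le, h.ge⟩⟩

theorem skel_eq_iff {X Y : Sub Unit} :
    X.skel = Y.skel ↔ X.skelHeight = Y.skelHeight ∧ X.stem = Y.stem := by
  simp [Sub.skel]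

/-- The node ahead is hidden and the center of the skeleton. -/
theorem sink_skelAhead_hidden (d : ZMod 6) {X Y Z : Sub Unit} (hX : X.isLeaf = false)
    (hY : Y.isLeaf = false) (hZ : Z.isLeaf = false) :
    (Drawing.mk d () (.node () X () Y) Z).Sink SkelAhead ↔
      Z.skelHeight ≤ max X.skelHeight Y.skelHeight ∧ X.skelHeight ≤ max Y.skelHeight Z.skelHeight ∧
        Y.skelHeight ≤ max Z.skelHeight X.skelHeight := by
  simp only [Sink, SkelAhead, Drawing.rot, Sub.skel_lt_iff, Sub.skelHeight, Sub.stem, hX, hY, hZ,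
    Sub.isLeaf_node, Bool.false_eq_true, if_false, true_and]
  omega

/-- The node ahead is exposed and the center of the skeleton, seen from its leaf. -/
theorem sink_skelAhead_exposed (d : ZMod 6) {X Y : Sub Unit} (hX : X.isLeaf = false)
    (hY : Y.isLeaf = false) :
    (Drawing.mk d () (.node () X () Y) .leaf).Sink SkelAhead ↔ X.skel = Y.skel := by
  have h1 := mt (Sub.skelHeight_eq_zero X).1 (by simp [hX])
  rw [skel_eq_iff]
  simp only [Sink, SkelAhead, Drawing.rot, Sub.skel_lt_iff, Sub.skelHeight, Sub.stem, hX, hY,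
    Sub.isLeaf_leaf, Sub.isLeaf_node, Bool.false_eq_true, if_false, if_true, true_and]
  omega

/-- If two branches are leaves, the node seen from the third has skeleton height `1` and stem `0`.
The third must be smaller, hence a leaf, and there is only one node. -/
theorem Sink.fewLeaves {D : Drawing Unit} (h : D.Sink SkelAhead) (hn : 2 ≤ D.numNodes) :
    FewLeaves D := by
  obtain ⟨d, a, _ | ⟨b, X, c, Y⟩, Z⟩ := D
  · exact absurd h.1 (by simp)
  have hX := Sub.skelHeight_eq_zero X
  have hY := Sub.skelHeight_eq_zero Y
  have hZ := Sub.skelHeight_eq_zero Z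
  have hX' (h : X.isLeaf = true) : X.numNodes = 0 := by rw [Sub.eq_leaf_of_isLeaf h]; rfl
  have hY' (h : Y.isLeaf = true) : Y.numNodes = 0 := by rw [Sub.eq_leaf_of_isLeaf h]; rfl
  have hZ' (h : Z.isLeaf = true) : Z.numNodes = 0 := by rw [Sub.eq_leaf_of_isLeaf h]; rfl
  simp only [Sink, SkelAhead, Drawing.rot, Sub.skel_lt_iff, Sub.skelHeight, Sub.stem] at h
  simp only [Drawing.numNodes, Sub.numNodes] at hn
  simp only [FewLeaves]
  cases h1 : X.isLeaf <;> cases h2 : Y.isLeaf <;> cases h3 : Z.isLeaf <;>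
    simp_all

/-- The construction shifts skeleton heights by one, so the center is kept, and the two halves of a
center strip have equal length, so the stems tie in its middle. -/
theorem Produces.eq_unbuild {c : MarkedTree Strip} {t : MarkedTree Unit} (h : Produces c t)
    (hc : WellLabelled c) :
    ∃ D : Drawing Unit, .mk D = t ∧ D.Normal SkelAhead ∧ unbuild D = c := by
  cases h with
  | node d a b c X Y Z hD =>
    rw [isCenterNode_iff_sink] at hD
    obtain ⟨ha, ⟨⟨hb, hX⟩, hc, hY⟩, hZ⟩ := (wellLabelled_sink hD).1 hc
    simp only at ha hb hc hX hY hZ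
    have hS : (Drawing.mk d () (.node () (hang b.sides (expand X)) () (hang c.sides (expand Y)))
        (hang a.sides (expand Z))).Sink SkelAhead := by
      rw [sink_skelAhead_hidden _ (by simp) (by simp) (by simp)]
      rw [sink_centerAhead] at hD
      simp only [skelHeight_hang_expand]
      omega
    refine ⟨_, mk_nodeRep _, hS.nodeRep, (unbuild_nodeRep hS ?_).trans ?_⟩
    · simp [FewLeaves]
    · have h1 := hS.2.1.ne'
      simp only at h1
      simp only [unbuild, if_neg h1, isLeaf_hang_expand, Bool.false_eq_true, if_false,
        contract_hang_expand hX, contract_hang_expand hY, contract_hang_expand hZ,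
        Strip.plain_sides ha, Strip.plain_sides hb, Strip.plain_sides hc]
  | even d s m X Y hd hD hs =>
    rw [isCenterEdge_iff] at hD
    obtain ⟨-, hX, hY⟩ := (wellLabelled_flat hD).1 hc
    simp only at hD
    have hS : (hang (s.drop m).reverse (expand X)).skel = (hang (s.take m) (expand Y)).skel := by
      simp [skel_eq_iff, hD]; omega
    refine ⟨_, rfl, Or.inl ⟨(flat_skelAhead _).2 hS, hd⟩, ?_⟩
    simp only [unbuild, if_pos hS, contract_hang_expand hX, contract_hang_expand hY,
      List.reverse_reverse, List.take_append_drop]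
  | bottom d s m X Y hd hD hs | top d s m X Y hd hD hs =>
    rw [isCenterEdge_iff] at hD
    obtain ⟨-, hX, hY⟩ := (wellLabelled_flat hD).1 hc
    simp only at hD
    refine ⟨_, mk_nodeRep _, Sink.nodeRep ((sink_skelAhead_exposed _ (by simp) (by simp)).2 ?_),
      (unbuild_nodeRep ((sink_skelAhead_exposed _ (by simp) (by simp)).2 ?_) ?_).trans ?_⟩
    · simp [skel_eq_iff, hD]; omega
    · simp [skel_eq_iff, hD]; omega
    · simp [FewLeaves]
    · have h1 (d : ZMod 6) (X Y : Sub Unit) (hX : X.isLeaf = false) :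
          unbuild ⟨d, (), .node () X () Y, .leaf⟩ = oddConfig d X Y := by
        have h2 : (Sub.node () X () Y).skel ≠ Sub.leaf.skel := by
          rw [Ne, skel_eq_iff]
          have := Sub.skelHeight_eq_zero (.node () X () Y)
          simp only [Sub.isLeaf_node, Bool.false_eq_true, iff_false] at this
          exact fun h => this h.1
        simp only [unbuild, if_neg h2, Sub.isLeaf_leaf, if_true]
      rw [h1 _ _ _ (by simp), oddConfig]
      simp only [isUp_add_three, hd, not_true, if_true, if_false, contract_hang_expand hX,
        contract_hang_expand hY, List.reverse_reverse, List.take_append_drop, add_three_add_three]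

theorem Produces.injective {c c' : MarkedTree Strip} {t : MarkedTree Unit} (h : Produces c t)
    (h' : Produces c' t) (hc : WellLabelled c) (hc' : WellLabelled c') : c = c' := by
  obtain ⟨D, rfl, hD, rfl⟩ := h.eq_unbuild hc
  obtain ⟨D', h1, hD', rfl⟩ := h'.eq_unbuild hc'
  rw [← compass_skelAhead.rep_of_normal trivial hD, ← compass_skelAhead.rep_eq h1 trivial,
    compass_skelAhead.rep_of_normal trivial hD']

theorem produces_oddConfig (d : ZMod 6) {X Y : Sub Unit} (hX : X.isLeaf = false)
    (hY : Y.isLeaf = false) (h : X.skel = Y.skel) :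
    WellLabelled (oddConfig d X Y) ∧
      Produces (oddConfig d X Y) (.mk ⟨d, (), .node () X () Y, .leaf⟩) := by
  rw [skel_eq_iff, skelHeight_eq hX, skelHeight_eq hY, stem_eq hX, stem_eq hY] at h
  have h1 : ((contract X).1 ++ (contract Y).1.reverse).length = 2 * (contract X).1.length := by
    simp; omega
  unfold oddConfig
  split_ifs with hd
  · constructor
    · rw [wellLabelled_flat (by omega)]
      refine ⟨?_, plain_contract _, plain_contract _⟩
      simp only [Strip.IsTweaked, Strip.length, h1, true_iff]
      exact odd_two_mul_add_one _
    · have := Produces.bottom d _ _ _ _ hd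
        ((isCenterEdge_iff ⟨d, .tweaked .B ((contract X).1 ++ (contract Y).1.reverse),
          (contract Y).2, (contract X).2⟩).2 (by simp only; omega)) h1
      simpa [hang_contract hX, hang_contract hY] using this
  · constructor
    · rw [wellLabelled_flat (by omega)]
      refine ⟨?_, plain_contract _, plain_contract _⟩
      simp only [Strip.IsTweaked, Strip.length, h1, true_iff]
      exact odd_two_mul_add_one _
    · have := Produces.top (d + 3) _ _ _ _ ((isUp_add_three d).2 hd)
        ((isCenterEdge_iff ⟨d + 3, .tweaked .T ((contract X).1 ++ (contract Y).1.reverse),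
          (contract X).2, (contract Y).2⟩).2 (by simp only; omega)) h1
      simpa [hang_contract hX, hang_contract hY, add_three_add_three] using this

theorem Produces.surjective {t : MarkedTree Unit} (ht : 2 ≤ t.numNodes) :
    ∃ c, WellLabelled c ∧ Produces c t := by
  induction t using Quot.ind with
  | mk D =>
  have h1 := compass_skelAhead.normal_rep D trivial
  rw [show Quot.mk _ D = MarkedTree.mk D from rfl, ← mk_rep SkelAhead] at ht ⊢
  generalize rep SkelAhead D = E at *
  rw [mk_numNodes] at ht
  rcases h1 with ⟨h1, hd⟩ | ⟨h1, -⟩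
  · rw [flat_skelAhead, skel_eq_iff] at h1
    obtain ⟨d, a, X, Z⟩ := E
    have hX : X.isLeaf = false := by
      by_contra hX
      simp only [Bool.not_eq_false] at hX
      simp only [(Sub.skelHeight_eq_zero X).2 hX] at h1
      have hZ := (Sub.skelHeight_eq_zero Z).1 h1.1.symm
      rw [Sub.eq_leaf_of_isLeaf hX, Sub.eq_leaf_of_isLeaf hZ] at ht
      simp [Drawing.numNodes, Sub.numNodes] at ht
    have hZ : Z.isLeaf = false := by
      by_contra hZ
      simp only [Bool.not_eq_false, ← Sub.skelHeight_eq_zero] at hZ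
      simp only [hZ, Sub.skelHeight_eq_zero, hX, Bool.false_eq_true, false_and] at h1
    simp only [skelHeight_eq hX, skelHeight_eq hZ, stem_eq hX, stem_eq hZ] at h1
    have h2 : ((contract Z).1 ++ (contract X).1.reverse).length = 2 * (contract Z).1.length := by
      simp; omega
    refine ⟨.mk ⟨d, .plain ((contract Z).1 ++ (contract X).1.reverse), (contract X).2,
      (contract Z).2⟩, ?_, ?_⟩
    · rw [wellLabelled_flat (by omega)]
      refine ⟨?_, plain_contract _, plain_contract _⟩
      simp only [Strip.IsTweaked, Strip.length, h2, false_iff, Nat.not_odd_iff_even]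
      exact even_two_mul _
    · have := Produces.even d _ _ _ _ hd
        ((isCenterEdge_iff ⟨d, .plain ((contract Z).1 ++ (contract X).1.reverse),
          (contract X).2, (contract Z).2⟩).2 (by simp only; omega)) h2
      simpa [hang_contract hX, hang_contract hZ] using this
  -- At an exposed center, rotation brings the leaf behind the traveller.
  · have key (R : Drawing Unit) (hR : R.Sink SkelAhead) (hn : FewLeaves R)
        (hb : R.back.isLeaf = true) : ∃ c, WellLabelled c ∧ Produces c (.mk R) := by
      obtain ⟨d, a, _ | ⟨b, X, c, Y⟩, Z⟩ := R
      · exact absurd hR.1 (by simp)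
      · simp only at hb
        simp only [FewLeaves, hb, Bool.true_eq_false, false_and, and_false, or_false] at hn
        rw [Sub.eq_leaf_of_isLeaf hb] at hR ⊢
        exact ⟨_, produces_oddConfig d hn.1 hn.2 ((sink_skelAhead_exposed d hn.1 hn.2).1 hR)⟩
    have hn := Sink.fewLeaves h1 ht
    obtain ⟨d, a, _ | ⟨b, X, c, Y⟩, Z⟩ := E
    · exact absurd h1.1 (by simp)
    by_cases hZ : Z.isLeaf = true
    · exact key _ h1 hn hZ
    by_cases hX : X.isLeaf = true
    · rw [← mk_rot]
      exact key _ h1.rot hn.rot hX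
    by_cases hY : Y.isLeaf = true
    · rw [← mk_rot, ← mk_rot]
      exact key _ h1.rot.rot hn.rot.rot hY
    simp only [Bool.not_eq_true] at hX hY hZ
    have h2 := (sink_skelAhead_hidden d hX hY hZ).1 h1
    simp only [skelHeight_eq hX, skelHeight_eq hY, skelHeight_eq hZ] at h2
    have hS : (Drawing.mk d (.plain (contract Z).1) (.node (.plain (contract X).1) (contract X).2
          (.plain (contract Y).1) (contract Y).2) (contract Z).2).Sink CenterAhead := by
      rw [sink_centerAhead]; omega
    refine ⟨_, (wellLabelled_sink hS).2 ⟨id, ⟨⟨id, plain_contract _⟩, id, plain_contract _⟩,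
      plain_contract _⟩, ?_⟩
    have := Produces.node _ _ _ _ _ _ _ ((isCenterNode_iff_sink _).2 hS)
    simpa [hang_contract hX, hang_contract hY, hang_contract hZ, Strip.sides] using this


/-! ### Counting marked trees by normal forms -/

theorem Drawing.Compass.card_eq {α : Type} {P F : Drawing α → Prop} (C : Compass P F)
    (Q : MarkedTree α → Prop) (hQ : ∀ D, Q (.mk D) → P D) :
    Nat.card {t // Q t} = Nat.card {D : Drawing α // D.Normal F ∧ Q (.mk D)} := by
  refine (Nat.card_congr (Equiv.ofBijective (fun D => ⟨.mk D.1, D.2.2⟩) ⟨?_, ?_⟩)).symm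
  · rintro ⟨D, hD, hD'⟩ ⟨E, hE, hE'⟩ h
    simp only [Subtype.mk.injEq] at h ⊢
    rw [← C.rep_of_normal (hQ D hD') hD, C.rep_eq h (hQ D hD'), C.rep_of_normal (hQ E hE') hE]
  · rintro ⟨t, ht⟩
    induction t using Quot.ind with
    | mk D =>
      have h := mk_rep F D
      exact ⟨⟨rep F D, C.normal_rep D (hQ D ht), by rwa [h]⟩, Subtype.ext h⟩

namespace Sub

variable {α β : Type}

/-- Change the marks. -/
def map (f : α → β) : Sub α → Sub β
  | leaf => leaf
  | node a l b r => node (f a) (l.map f) (f b) (r.map f)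

/-- The list of marks. -/
def marks : Sub α → List α
  | leaf => []
  | node a l b r => (a :: l.marks) ++ (b :: r.marks)

@[simp] theorem height_map (f : α → β) (X : Sub α) : (X.map f).height = X.height := by
  induction X with
  | leaf => rfl
  | node a l b r ihl ihr => simp only [map, height, ihl, ihr]

@[simp] theorem numNodes_map (f : α → β) (X : Sub α) : (X.map f).numNodes = X.numNodes := by
  induction X with
  | leaf => rfl
  | node a l b r ihl ihr => simp only [map, numNodes, ihl, ihr]

theorem weight_map (w : β → ℕ) (f : α → β) (X : Sub α) :
    (X.map f).weight w = X.weight (fun a => w (f a)) := by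
  induction X with
  | leaf => rfl
  | node a l b r ihl ihr => simp only [map, weight, ihl, ihr]

theorem length_marks (X : Sub α) : X.marks.length = 2 * X.numNodes := by
  induction X with
  | leaf => rfl
  | node a l b r ihl ihr =>
    simp only [marks, numNodes, List.length_append, List.length_cons, ihl, ihr]; omega

theorem sum_marks (w : α → ℕ) (X : Sub α) : (X.marks.map w).sum = X.weight w := by
  induction X with
  | leaf => rfl
  | node a l b r ihl ihr =>
    simp only [marks, weight, List.map_append, List.sum_append, List.map_cons, List.sum_cons,
      ihl, ihr]

/-- The shape, without marks. -/
abbrev shape (X : Sub α) : Sub Unit := X.map fun _ => ()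

theorem shape_marks_injective {X Y : Sub α} (h : X.shape = Y.shape) (h' : X.marks = Y.marks) :
    X = Y := by
  induction X generalizing Y with
  | leaf => cases Y with
    | leaf => rfl
    | node => simp [shape, map] at h
  | node a l b r ihl ihr => cases Y with
    | leaf => simp [shape, map] at h
    | node a' l' b' r' =>
      simp only [shape, map, node.injEq, true_and] at h
      have hl : l.numNodes = l'.numNodes := by
        rw [← numNodes_map (fun _ => ()) l, h.1, numNodes_map]
      have := List.append_inj h' (by simp [length_marks, hl])
      simp only [List.cons.injEq] at this
      obtain ⟨⟨rfl, h1⟩, rfl, h2⟩ := this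
      rw [ihl h.1 h1, ihr h.2 h2]

theorem exists_shape_marks (S : Sub Unit) (L : List α) (h : L.length = 2 * S.numNodes) :
    ∃ X : Sub α, X.shape = S ∧ X.marks = L := by
  induction S generalizing L with
  | leaf => exact ⟨leaf, rfl, (List.length_eq_zero_iff.1 h).symm⟩
  | node _ l _ r ihl ihr =>
    simp only [numNodes] at h
    -- The first block holds the mark of the left edge and the `2 * l.numNodes` marks beyond it.
    obtain ⟨L1, L2, rfl, h1⟩ : ∃ L1 L2, L = L1 ++ L2 ∧ L1.length = 2 * l.numNodes + 1 :=
      ⟨L.take (2 * l.numNodes + 1), L.drop (2 * l.numNodes + 1), by simp, by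
        rw [List.length_take]; omega⟩
    rw [List.length_append] at h
    cases L1 with
    | nil => simp at h1
    | cons a L1 =>
      cases L2 with
      | nil => simp at h h1; omega
      | cons b L2 =>
        simp only [List.length_cons] at h h1
        obtain ⟨X, hX, rfl⟩ := ihl L1 (by omega)
        obtain ⟨Y, hY, rfl⟩ := ihr L2 (by omega)
        exact ⟨.node a X b Y, by simp only [shape, map] at hX hY ⊢; rw [hX, hY], rfl⟩

theorem map_injective {f : α → β} (hf : Function.Injective f) : Function.Injective (map f) := by
  intro X
  induction X with
  | leaf => intro Y h; cases Y with
    | leaf => rfl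
    | node => simp [map] at h
  | node a l b r ihl ihr => intro Y h; cases Y with
    | leaf => simp [map] at h
    | node a' l' b' r' =>
      simp only [map, node.injEq] at h
      rw [hf h.1, ihl h.2.1, hf h.2.2.1, ihr h.2.2.2]

end Sub

namespace Drawing

variable {α : Type}

def shape (D : Drawing α) : Drawing Unit := ⟨D.dir, (), D.front.shape, D.back.shape⟩

def marks (D : Drawing α) : List α := D.mark :: (D.front.marks ++ D.back.marks)

theorem sink_iff_of_heights {β : Type} {d : ZMod 6} {a : α} {a' : β} {X Y : Sub α} {f : α → β} :
    (Drawing.mk d a' (X.map f) (Y.map f)).Sink CenterAhead ↔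
      (Drawing.mk d a X Y).Sink CenterAhead := by
  cases X with
  | leaf => simp [Sink, Sub.map]
  | node b X c Z => simp only [Sub.map, sink_centerAhead, Sub.height_map]

theorem normal_iff_of_heights {β : Type} {d : ZMod 6} {a : α} {a' : β} {X Y : Sub α} {f : α → β} :
    (Drawing.mk d a' (X.map f) (Y.map f)).Normal CenterAhead ↔
      (Drawing.mk d a X Y).Normal CenterAhead := by
  simp only [Normal, sink_iff_of_heights (a := a), flat_centerAhead, Sub.height_map]

end Drawing

open Drawing

/-- Heights ignore marks, so a normal marked drawing is a normal shape together with an arbitrary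
list of marks on its `2 * k + 1` edges. -/
theorem card_marked {β : Type} (w : β → ℕ) (k N : ℕ) :
    Nat.card {t : MarkedTree β // t.numNodes = k ∧ t.weight w = N} =
      Nat.card (CTree k) *
        Nat.card {L : List β // L.length = 2 * k + 1 ∧ (L.map w).sum = N} := by
  rw [CTree, compass_centerAhead.card_eq _ (fun _ _ => trivial),
    compass_centerAhead.card_eq _ (fun _ _ => trivial), ← Nat.card_prod]
  have hn (D : Drawing β) : D.shape.numNodes = D.numNodes := by
    simp [Drawing.numNodes, Drawing.shape]
  have hw (D : Drawing β) : (D.marks.map w).sum = D.weight w := by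
    simp [Drawing.marks, Drawing.weight, Sub.sum_marks, add_assoc]
  have hl (D : Drawing β) : D.marks.length = 2 * D.numNodes + 1 := by
    simp [Drawing.marks, Drawing.numNodes, Sub.length_marks]; omega
  refine Nat.card_congr (Equiv.ofBijective
    (fun D => (⟨D.1.shape, normal_iff_of_heights.2 D.2.1, (hn D.1).trans D.2.2.1⟩,
      ⟨D.1.marks, (hl D.1).trans (congrArg (2 * · + 1) D.2.2.1), (hw D.1).trans D.2.2.2⟩)) ⟨?_, ?_⟩)
  · rintro ⟨⟨d, a, X, Y⟩, hD⟩ ⟨⟨d', a', X', Y'⟩, hD'⟩ h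
    simp only [Prod.mk.injEq, Subtype.mk.injEq, Drawing.shape, Drawing.marks, Drawing.mk.injEq,
      List.cons.injEq, true_and] at h ⊢
    obtain ⟨⟨h1, h2, h3⟩, h4, h5⟩ := h
    have hX : X.numNodes = X'.numNodes := by
      simpa using congrArg Sub.numNodes h2
    have := List.append_inj h5 (by simp [Sub.length_marks, hX])
    exact ⟨h1, h4, Sub.shape_marks_injective h2 this.1, Sub.shape_marks_injective h3 this.2⟩
  · rintro ⟨⟨⟨d, a, X, Y⟩, hD, hk⟩, ⟨L, hL, hN⟩⟩
    rw [mk_numNodes] at hk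
    simp only [Drawing.numNodes] at hk
    cases L with
    | nil => simp at hL
    | cons b L =>
      simp only [List.length_cons] at hL
      obtain ⟨X', rfl, hX⟩ := Sub.exists_shape_marks X (L.take (2 * X.numNodes)) (by
        rw [List.length_take]; omega)
      obtain ⟨Y', rfl, hY⟩ := Sub.exists_shape_marks Y (L.drop (2 * X'.shape.numNodes)) (by
        rw [List.length_drop]; omega)
      have hE : Drawing.marks ⟨d, b, X', Y'⟩ = b :: L := by
        simp [Drawing.marks, hX, hY]
      refine ⟨⟨⟨d, b, X', Y'⟩, normal_iff_of_heights.1 hD, ?_, ?_⟩, ?_⟩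
      · simpa [mk_numNodes, Drawing.numNodes] using hk
      · rw [mk_weight, ← hw, hE, hN]
      · exact Prod.ext (Subtype.ext rfl) (Subtype.ext hE)

/-- The lengths form a weak composition of `N` into `j + 1` parts, and the `N` letters are free. -/
theorem card_lists {γ : Type} [Fintype γ] (j N : ℕ) :
    Finite {L : List (List γ) // L.length = j + 1 ∧ (L.map List.length).sum = N} ∧
    Nat.card {L : List (List γ) // L.length = j + 1 ∧ (L.map List.length).sum = N} =
      Fintype.card γ ^ N * (N + j).choose j := by
  induction j generalizing N with
  | zero =>
    have e : List.Vector γ N ≃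
        {L : List (List γ) // L.length = 0 + 1 ∧ (L.map List.length).sum = N} :=
      Equiv.ofBijective (fun v => ⟨[v.1], by simp, by simp⟩) ⟨fun v v' h => by
        simp only [Subtype.mk.injEq, List.cons.injEq, and_true] at h
        exact Subtype.ext h, by
        rintro ⟨L, hL, hN⟩
        obtain ⟨s, rfl⟩ := List.length_eq_one_iff.1 hL
        exact ⟨⟨s, by simpa using hN⟩, rfl⟩⟩
    exact ⟨Finite.of_equiv _ e, by
      rw [← Nat.card_congr e, Nat.card_eq_fintype_card, card_vector]; simp⟩
  | succ j ih =>
    have e : (Σ i : Fin (N + 1), List.Vector γ i.1 ×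
          {L : List (List γ) // L.length = j + 1 ∧ (L.map List.length).sum = N - i.1}) ≃
        {L : List (List γ) // L.length = j + 1 + 1 ∧ (L.map List.length).sum = N} :=
      Equiv.ofBijective (fun p => ⟨p.2.1.1 :: p.2.2.1, by simp [p.2.2.2.1], by
          have := p.1.2
          rw [List.map_cons, List.sum_cons, p.2.2.2.2, p.2.1.2]; omega⟩) ⟨by
        rintro ⟨⟨i, hi⟩, ⟨s, hs⟩, ⟨L, hL⟩⟩ ⟨⟨i', hi'⟩, ⟨s', hs'⟩, ⟨L', hL'⟩⟩ h
        simp only [Subtype.mk.injEq, List.cons.injEq] at h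
        obtain ⟨rfl, rfl⟩ := h
        simp only at hs hs'
        subst hs; subst hs'
        rfl, by
        rintro ⟨_ | ⟨s, L⟩, hL, hN⟩
        · simp at hL
        · simp only [List.map_cons, List.sum_cons, List.length_cons] at hN hL
          exact ⟨⟨⟨s.length, by omega⟩, ⟨s, rfl⟩, ⟨L, by omega, by simp only; omega⟩⟩, rfl⟩⟩
    have := fun M => (ih M).1
    refine ⟨Finite.of_equiv _ e, ?_⟩
    rw [← Nat.card_congr e, Nat.card_sigma]
    simp only [Nat.card_prod, (ih _).2, Nat.card_eq_fintype_card, card_vector]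
    -- After reversing the sum over the first length, this is the hockey-stick identity.
    rw [Fin.sum_univ_eq_sum_range (fun i => Fintype.card γ ^ i *
      (Fintype.card γ ^ (N - i) * (N - i + j).choose j)), ← add_assoc, ← Nat.sum_range_add_choose,
      ← Finset.sum_range_reflect, Finset.mul_sum]
    refine Finset.sum_congr rfl fun i hi => ?_
    rw [Finset.mem_range] at hi
    rw [← mul_assoc, ← pow_add]
    congr 2 <;> [skip; congr 1] <;> omega

/-! ### The number of trees -/

theorem card_isUp : Nat.card {d : ZMod 6 // IsUp d} = 3 := by
  rw [Nat.card_eq_fintype_card]; decide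

def toBinaryTree : Sub Unit → BinaryTree Unit
  | .leaf => .nil
  | .node _ l _ r => .node () (toBinaryTree l) (toBinaryTree r)

def ofBinaryTree : BinaryTree Unit → Sub Unit
  | .nil => .leaf
  | .node _ l r => .node () (ofBinaryTree l) () (ofBinaryTree r)

def binaryTreeEquiv : Sub Unit ≃ BinaryTree Unit where
  toFun := toBinaryTree
  invFun := ofBinaryTree
  left_inv X := by
    induction X with
    | leaf => rfl
    | node _ l _ r ihl ihr => simp [toBinaryTree, ofBinaryTree, ihl, ihr]
  right_inv X := by
    induction X with
    | nil => rfl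
    | node _ l r ihl ihr => simp [toBinaryTree, ofBinaryTree, ihl, ihr]

theorem numNodes_toBinaryTree (X : Sub Unit) : (toBinaryTree X).numNodes = X.numNodes := by
  induction X with
  | leaf => rfl
  | node _ l _ r ihl ihr =>
    simp only [toBinaryTree, BinaryTree.numNodes, Sub.numNodes, ihl, ihr]; omega

theorem card_sub (n : ℕ) : Nat.card {X : Sub Unit // X.numNodes = n} = catalan n := by
  rw [← BinaryTree.treesOfNumNodesEq_card_eq_catalan, ← Fintype.card_coe,
    ← Nat.card_eq_fintype_card]
  refine Nat.card_congr (binaryTreeEquiv.subtypeEquiv fun X => ?_)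
  rw [BinaryTree.mem_treesOfNumNodesEq, ← numNodes_toBinaryTree]
  rfl

theorem map_shape_of_weight_eq_zero {X : Sub (List Unit)} (h : X.weight List.length = 0) :
    X.shape.map (fun _ => ([] : List Unit)) = X := by
  induction X with
  | leaf => rfl
  | node a l b r ihl ihr =>
    simp only [Sub.weight, Nat.add_eq_zero_iff, List.length_eq_zero_iff] at h
    simp only [Sub.shape, Sub.map] at ihl ihr ⊢
    rw [ihl h.1.2, ihr h.2.2, h.1.1, h.2.1]

theorem shape_map_nil (X : Sub Unit) : (X.map fun _ => ([] : List Unit)).shape = X := by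
  induction X with
  | leaf => rfl
  | node a l b r ihl ihr => simp only [Sub.shape, Sub.map] at ihl ihr ⊢; rw [ihl, ihr]

theorem weight_map_nil (X : Sub Unit) :
    (X.map fun _ => ([] : List Unit)).weight List.length = 0 := by
  induction X with
  | leaf => rfl
  | node a l b r ihl ihr => simp [Sub.map, Sub.weight, ihl, ihr]

/-- Trees with a distinguished edge. -/
theorem card_edge_pointed (n : ℕ) :
    Nat.card {t : MarkedTree (List Unit) // t.numNodes = n ∧ t.weight List.length = 1} =
      3 * catalan (n + 1) := by
  rw [(compass_markAhead List.length).card_eq _ (fun _ h => h.2), ← card_isUp, ← card_sub,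
    ← Nat.card_prod]
  have hN (D : Drawing (List Unit)) (h : (MarkedTree.mk D).weight List.length = 1) :=
    normal_markAhead List.length D h
  -- The normal traveller goes up the marked edge, in one of three directions. Joining the parts
  -- ahead and behind under a new root gives a binary tree with `n + 1` nodes.
  refine Nat.card_congr (Equiv.ofBijective (fun D =>
    (⟨D.1.dir, ((hN D.1 D.2.2.2).1 D.2.1).2.2⟩,
     ⟨.node () D.1.front.shape () D.1.back.shape, by
      have := D.2.2.1
      rw [mk_numNodes, Drawing.numNodes] at this
      simp only [Sub.numNodes, Sub.numNodes_map]; omega⟩)) ⟨?_, ?_⟩)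
  · rintro ⟨D, hD, hn, hw⟩ ⟨D', hD', hn', hw'⟩ h
    rw [hN _ hw] at hD
    rw [hN _ hw'] at hD'
    simp only [Prod.mk.injEq, Subtype.mk.injEq, Sub.node.injEq, true_and] at h ⊢
    rw [mk_weight, Drawing.weight] at hw hw'
    obtain ⟨d, a, X, Y⟩ := D
    obtain ⟨d', a', X', Y'⟩ := D'
    simp only at h hD hD' hw hw'
    obtain ⟨rfl, hX, hY⟩ := h
    rw [← map_shape_of_weight_eq_zero hD.1, ← map_shape_of_weight_eq_zero hD.2.1,
      ← map_shape_of_weight_eq_zero hD'.1, ← map_shape_of_weight_eq_zero hD'.2.1, hX, hY]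
    congr 1
    -- The mark is a list over `Unit`, determined by its length, which is `1` since all other marks
    -- are empty.
    exact List.length_injective (by omega)
  · rintro ⟨⟨d, hd⟩, ⟨_ | ⟨_, X, _, Y⟩, hX⟩⟩
    · simp [Sub.numNodes] at hX
    · simp only [Sub.numNodes] at hX
      have hw : (MarkedTree.mk (Drawing.mk d [()] (X.map fun _ => []) (Y.map fun _ => []))).weight
          List.length = 1 := by
        simp [mk_weight, Drawing.weight, weight_map_nil]
      refine ⟨⟨⟨d, [()], X.map fun _ => [], Y.map fun _ => []⟩, ?_, ?_, hw⟩, ?_⟩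
      · rw [hN _ hw]; exact ⟨weight_map_nil X, weight_map_nil Y, hd⟩
      · simp only [mk_numNodes, Drawing.numNodes, Sub.numNodes_map]; omega
      · simp only [shape_map_nil]

/-- Double count of trees with a distinguished edge: each `n`-ctree has `2 * n + 1` edges. -/
theorem card_cTree_mul (n : ℕ) :
    Nat.card (CTree n) * (2 * n + 1) = 3 * catalan (n + 1) := by
  rw [← card_edge_pointed, card_marked, (card_lists (2 * n) 1).2]
  simp [add_comm 1]

theorem card_cTree (n : ℕ) : (Nat.card (CTree n) : ℚ) = superCatalan 2 n := by
  have h1 : (Nat.card (CTree n) : ℚ) * (2 * n + 1) = 3 * catalan (n + 1) := by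
    exact_mod_cast card_cTree_mul n
  have h2 : ((n : ℚ) + 1 + 1) * catalan (n + 1) = (n + 1).centralBinom := by
    exact_mod_cast succ_mul_catalan_eq_centralBinom (n + 1)
  have h3 : ((n : ℚ) + 1) * (n + 1).centralBinom = 2 * (2 * n + 1) * (2 * n).choose n := by
    exact_mod_cast Nat.succ_mul_centralBinom_succ n
  have h4 : ((2 * 2).choose 2 : ℚ) = 6 := by norm_num [Nat.choose]
  have h5 : ((2 * n + 1 : ℕ) : ℚ) ≠ 0 := by positivity
  rw [superCatalan, h4, Nat.cast_choose_two]
  push_cast at h5 ⊢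
  -- The rewriting turns `2 + n - 1` into `2 - 1 + n`, which is visibly positive.
  rw [eq_div_iff (by rw [add_sub_right_comm]; positivity)]
  apply mul_right_cancel₀ h5
  linear_combination (n + 2) * (n + 1) * h1 + 3 * (n + 1) * h2 + 3 * h3

/-! ### The number of configurations -/

/-- The strip on a center edge for a list of `L`/`R` labels. -/
def label (s : List Side) : Strip :=
  if Odd s.length then
    match s with
    | [] => .plain []
    | .L :: s => .tweaked .T s
    | .R :: s => .tweaked .B s
  else .plain s

theorem length_label (s : List Side) : (label s).length = s.length := by
  unfold label
  split_ifs
  · rcases s with _ | ⟨_ | _, s⟩ <;> rfl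
  · rfl

theorem isTweaked_label (s : List Side) : (label s).IsTweaked ↔ Odd (label s).length := by
  rw [length_label]
  unfold label
  split_ifs with h
  · rcases s with _ | ⟨_ | _, s⟩
    · simp at h
    · simp only [Strip.IsTweaked, h]
    · simp only [Strip.IsTweaked, h]
  · simp [Strip.IsTweaked, h]

theorem label_injective : Function.Injective label := by
  intro s s' h
  have hl : s.length = s'.length := by rw [← length_label, h, length_label]
  unfold label at h
  rw [hl] at h
  split_ifs at h with h1
  · rcases s with _ | ⟨_ | _, s⟩ <;> rcases s' with _ | ⟨_ | _, s'⟩ <;> simp_all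
  · simpa using h

theorem exists_label {a : Strip} (h : a.IsTweaked ↔ Odd a.length) : ∃ s, label s = a := by
  rcases a with s | ⟨_ | _, s⟩
  · simp only [Strip.IsTweaked, Strip.length, false_iff] at h
    exact ⟨s, if_neg h⟩
  · simp only [Strip.IsTweaked, Strip.length, true_iff] at h
    exact ⟨.L :: s, if_pos h⟩
  · simp only [Strip.IsTweaked, Strip.length, true_iff] at h
    exact ⟨.R :: s, if_pos h⟩

theorem plain_map (X : Sub (List Side)) : (X.map Strip.plain).Plain := by
  induction X with
  | leaf => trivial
  | node a l b r ihl ihr => exact ⟨⟨id, ihl⟩, id, ihr⟩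

theorem map_sides {X : Sub Strip} (h : X.Plain) : (X.map Strip.sides).map Strip.plain = X := by
  induction X with
  | leaf => rfl
  | node a l b r ihl ihr =>
    obtain ⟨⟨h1, h2⟩, h3, h4⟩ := h
    simp only [Sub.map, ihl h2, ihr h4, Strip.plain_sides h1, Strip.plain_sides h3]

theorem weight_map_plain (X : Sub (List Side)) :
    (X.map Strip.plain).weight Strip.length = X.weight List.length :=
  Sub.weight_map _ _ _

theorem plain_injective : Function.Injective Strip.plain := fun _ _ h => Strip.plain.inj h

/-- The labelled strip on the central edge of a drawing, or on an edge at its center node. -/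
def labelAt (X Y : Sub (List Side)) (s : List Side) : Strip :=
  if X.height = Y.height then label s else .plain s

theorem length_labelAt (X Y : Sub (List Side)) (s : List Side) :
    (labelAt X Y s).length = s.length := by
  unfold labelAt
  split_ifs
  · exact length_label s
  · rfl

theorem labelAt_injective (X Y : Sub (List Side)) : Function.Injective (labelAt X Y) := by
  unfold labelAt
  split_ifs
  · exact label_injective
  · exact plain_injective

theorem wellLabelled_normal {D : Drawing Strip} (h : D.Normal CenterAhead) :
    WellLabelled (.mk D) ↔
      (D.mark.IsTweaked ↔ D.front.height = D.back.height ∧ Odd D.mark.length) ∧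
        D.front.Plain ∧ D.back.Plain := by
  rcases h with ⟨h, -⟩ | ⟨h, -⟩
  · rw [flat_centerAhead] at h
    rw [wellLabelled_flat h]
    simp only [h, true_and]
  · have h1 := h.2.1.ne'
    rw [wellLabelled_sink h]
    simp only [h1, false_and, iff_false]

/-- Renaming `T`, `B` to `L`, `R` on an odd center strip loses nothing, as the position and the
parity tell where to undo it. -/
theorem card_config_eq_card_marked (n k : ℕ) (hn : 2 + 2 * k ≤ n) :
    Nat.card (Config n k) = Nat.card {t : MarkedTree (List Side) //
      t.numNodes = k ∧ t.weight List.length = n - (2 + 2 * k)} := by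
  rw [Config, compass_centerAhead.card_eq _ (fun _ _ => trivial),
    compass_centerAhead.card_eq _ (fun _ _ => trivial)]
  have key (D : Drawing (List Side)) (h : D.Normal CenterAhead ∧ (MarkedTree.mk D).numNodes = k ∧
      (MarkedTree.mk D).weight List.length = n - (2 + 2 * k)) :
      (Drawing.mk D.dir (labelAt D.front D.back D.mark) (D.front.map .plain)
          (D.back.map .plain)).Normal CenterAhead ∧
        (MarkedTree.mk (Drawing.mk D.dir (labelAt D.front D.back D.mark) (D.front.map .plain)
          (D.back.map .plain))).numNodes = k ∧
        (MarkedTree.mk (Drawing.mk D.dir (labelAt D.front D.back D.mark) (D.front.map .plain)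
          (D.back.map .plain))).weight Strip.length + (2 + 2 * k) = n ∧
        WellLabelled (.mk (Drawing.mk D.dir (labelAt D.front D.back D.mark) (D.front.map .plain)
          (D.back.map .plain))) := by
    obtain ⟨d, a, X, Y⟩ := D
    obtain ⟨hD, hk, hw⟩ := h
    have hD' := (normal_iff_of_heights (a' := labelAt X Y a) (f := Strip.plain)).2 hD
    refine ⟨hD', ?_, ?_, ?_⟩
    · simpa [mk_numNodes, Drawing.numNodes] using hk
    · simp only [mk_weight, Drawing.weight, weight_map_plain, length_labelAt] at hw ⊢
      omega
    · rw [wellLabelled_normal hD']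
      refine ⟨?_, plain_map X, plain_map Y⟩
      simp only [Sub.height_map, labelAt]
      split_ifs with h
      · simp only [h, true_and, isTweaked_label]
      · simp [h, Strip.IsTweaked]
  refine (Nat.card_congr (Equiv.ofBijective (fun D => ⟨⟨D.1.dir,
    labelAt D.1.front D.1.back D.1.mark, D.1.front.map .plain, D.1.back.map .plain⟩,
    key D.1 D.2⟩) ⟨?_, ?_⟩)).symm
  · rintro ⟨⟨d, a, X, Y⟩, hD⟩ ⟨⟨d', a', X', Y'⟩, hD'⟩ h
    simp only [Subtype.mk.injEq, Drawing.mk.injEq] at h ⊢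
    obtain ⟨h1, h2, h3, h4⟩ := h
    obtain rfl := Sub.map_injective plain_injective h3
    obtain rfl := Sub.map_injective plain_injective h4
    exact ⟨h1, labelAt_injective _ _ h2, rfl, rfl⟩
  · rintro ⟨⟨d, a, X, Y⟩, hD, hk, hw, hL⟩
    rw [wellLabelled_normal hD] at hL
    obtain ⟨ha, hX, hY⟩ := hL
    simp only at ha hX hY
    obtain ⟨X', rfl⟩ : ∃ X', Sub.map .plain X' = X := ⟨_, map_sides hX⟩
    obtain ⟨Y', rfl⟩ : ∃ Y', Sub.map .plain Y' = Y := ⟨_, map_sides hY⟩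
    obtain ⟨s, rfl⟩ : ∃ s, labelAt X' Y' s = a := by
      simp only [Sub.height_map] at ha
      unfold labelAt
      split_ifs with h
      · simp only [h, true_and] at ha
        exact exists_label ha
      · simp only [h, false_and, iff_false] at ha
        exact ⟨_, Strip.plain_sides ha⟩
    refine ⟨⟨⟨d, s, X', Y'⟩, normal_iff_of_heights.1 hD, ?_, ?_⟩, rfl⟩
    · simpa [mk_numNodes, Drawing.numNodes] using hk
    · simp only [mk_weight, Drawing.weight, weight_map_plain, length_labelAt] at hw ⊢
      omega

instance : Fintype Side where
  elems := ⟨{.L, .R}, by simp⟩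
  complete s := by cases s <;> simp

theorem card_config {n : ℕ} (hn : 2 ≤ n) (k : ℕ) :
    Nat.card (Config n k) =
      (n - 2).choose (2 * k) * 2 ^ (n - 2 - 2 * k) * Nat.card (CTree k) := by
  rcases le_or_gt (2 + 2 * k) n with h | h
  · rw [card_config_eq_card_marked n k h, card_marked, (card_lists (2 * k) _).2]
    have h1 : n - (2 + 2 * k) + 2 * k = n - 2 := by omega
    have h2 : n - (2 + 2 * k) = n - 2 - 2 * k := by omega
    have h3 : Fintype.card Side = 2 := rfl
    rw [h1, h2, h3]
    ring
  · have : IsEmpty (Config n k) := ⟨fun c => by have := c.2.2.1; omega⟩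
    rw [Nat.card_of_isEmpty, Nat.choose_eq_zero_of_lt (by omega), zero_mul, zero_mul]


/-! ### The bijection and the sum -/

theorem Produces.card_nodes {c : MarkedTree Strip} {t : MarkedTree Unit} (h : Produces c t)
    (hc : WellLabelled c) :
    t.naked = c.numLeaves ∧ t.hidden = c.numNodes ∧ t.exposed = c.weight Strip.length := by
  have h1 := (h.numbers hc).1
  exact ⟨(h1 2).trans (by simp), (h1 0).trans (by simp), (h1 1).trans (by simp)⟩

theorem exists_equiv {n : ℕ} (hn : 2 ≤ n) (k : ℕ) :
    ∃ Φ : Config n k ≃ CTreeHidden n k,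
      ∀ (c : Config n k) (t : MarkedTree Unit), Produces c.1 t ↔ t = (Φ c).1.1 := by
  choose f hf using fun c : Config n k => Produces.exists c.2.2.2
  have hn' (c : Config n k) : (f c).numNodes = n := by
    rw [((hf c).numbers c.2.2.2).2, c.2.1, c.2.2.1]
  have hk (c : Config n k) : (f c).hidden = k :=
    ((hf c).card_nodes c.2.2.2).2.1.trans c.2.1
  refine ⟨Equiv.ofBijective (fun c => ⟨⟨f c, hn' c⟩, hk c⟩) ⟨?_, ?_⟩, fun c t =>
    ⟨fun h => h.unique (hf c), fun h => h ▸ hf c⟩⟩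
  · intro c c' h
    have h : f c = f c' := congrArg (fun t => t.1.1) h
    exact Subtype.ext ((h ▸ hf c).injective (hf c') c.2.2.2 c'.2.2.2)
  · rintro ⟨⟨t, ht⟩, hk'⟩
    obtain ⟨c, hc, h⟩ := Produces.surjective (ht ▸ hn : 2 ≤ t.numNodes)
    have h1 : c.numNodes = k := (h.card_nodes hc).2.1.symm.trans hk'
    have h2 := (h.numbers hc).2
    refine ⟨⟨c, h1, ?_, hc⟩, ?_⟩
    · rw [← ht, h2, h1]
    · exact Subtype.ext (Subtype.ext ((hf _).unique h))

/-- `Nat.card` vanishes on infinite types, so a nonzero count gives finiteness. -/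
theorem finite_cTree (n : ℕ) : Finite (CTree n) := by
  refine Nat.finite_of_card_ne_zero fun h => ?_
  have h1 := card_cTree_mul n
  have h2 := succ_mul_catalan_eq_centralBinom (n + 1)
  have h3 := Nat.centralBinom_pos (n + 1)
  rw [h, zero_mul, eq_comm, mul_eq_zero] at h1
  rw [h1.resolve_left (by norm_num)] at h2
  omega

/-- The tree comes from a configuration, for which `n` is the number of squares plus `2 + 2 * k`. -/
theorem hidden_lt {n : ℕ} (hn : 2 ≤ n) (t : CTree n) : t.1.hidden < n / 2 := by
  obtain ⟨c, hc, h⟩ := Produces.surjective (t.2.symm ▸ hn : 2 ≤ t.1.numNodes)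
  have h1 := (h.card_nodes hc).2.1
  have h2 := (h.numbers hc).2
  rw [t.2] at h2
  omega

theorem card_cTree_eq_sum {n : ℕ} (hn : 2 ≤ n) :
    Nat.card (CTree n) = ∑ k ∈ Finset.range (n / 2), Nat.card (CTreeHidden n k) := by
  have := finite_cTree n
  have e : CTree n ≃ Σ k : Fin (n / 2), CTreeHidden n k :=
    (Equiv.sigmaFiberEquiv fun t : CTree n => (⟨t.1.hidden, hidden_lt hn t⟩ : Fin (n / 2))).symm.trans
      (Equiv.sigmaCongrRight fun k => Equiv.subtypeEquivRight fun t => by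
        rw [Fin.ext_iff])
  have (k : ℕ) : Finite (CTreeHidden n k) := Subtype.finite
  rw [Nat.card_congr e, Nat.card_sigma, Fin.sum_univ_eq_sum_range fun k =>
    Nat.card (CTreeHidden n k)]

end AlignedCubic

theorem mainTheorem1 :
    (∀ n : ℕ, (Nat.card (AlignedCubic.CTree n) : ℚ) = AlignedCubic.superCatalan 2 n) ∧
    (∀ n : ℕ, 2 ≤ n →
      (∀ k : ℕ, ∃ Φ : AlignedCubic.Config n k ≃ AlignedCubic.CTreeHidden n k,
        (∀ (c : AlignedCubic.Config n k) (t : AlignedCubic.MarkedTree Unit),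
          AlignedCubic.Produces c.1 t ↔ t = (Φ c).1.1) ∧
        (∀ c : AlignedCubic.Config n k,
          (Φ c).1.1.naked = c.1.numLeaves ∧
          (Φ c).1.1.hidden = c.1.numNodes ∧
          (Φ c).1.1.exposed = c.1.weight AlignedCubic.Strip.length)) ∧
      (∀ k : ℕ,
        Nat.card (AlignedCubic.Config n k)
          = (n - 2).choose (2 * k) * 2 ^ (n - 2 - 2 * k) * Nat.card (AlignedCubic.CTree k) ∧
        Nat.card (AlignedCubic.CTreeHidden n k)
          = (n - 2).choose (2 * k) * 2 ^ (n - 2 - 2 * k) * Nat.card (AlignedCubic.CTree k)) ∧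
      Nat.card (AlignedCubic.CTree n)
        = ∑ k ∈ Finset.range (n / 2),
            (n - 2).choose (2 * k) * 2 ^ (n - 2 - 2 * k) * Nat.card (AlignedCubic.CTree k) ∧
      AlignedCubic.superCatalan 2 n
        = ∑ k ∈ Finset.range (n / 2),
            ((n - 2).choose (2 * k) : ℚ) * 2 ^ (n - 2 - 2 * k)
              * AlignedCubic.superCatalan 2 k) := by
  refine ⟨AlignedCubic.card_cTree, fun n hn => ?_⟩
  have hc := AlignedCubic.card_config hn
  have hh (k : ℕ) := (Nat.card_congr (AlignedCubic.exists_equiv hn k).choose).symm.trans (hc k)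
  have hs := AlignedCubic.card_cTree_eq_sum hn
  simp only [hh] at hs
  refine ⟨fun k => ?_, fun k => ⟨hc k, hh k⟩, hs, ?_⟩
  · obtain ⟨Φ, hΦ⟩ := AlignedCubic.exists_equiv hn k
    exact ⟨Φ, hΦ, fun c => ((hΦ c _).2 rfl).card_nodes c.2.2.2⟩
  · rw [← AlignedCubic.card_cTree, hs]
    push_cast
    simp only [AlignedCubic.card_cTree]
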